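/- **Theorem.** Let $\mathbb F_q$ be a finite field with $q$ elements, $a\in\mathbb F_q^*$ an element of multiplicative order $\operatorname{ord}(a)$, and $n$ a positive integer with $\gcd(n,q)=1$. Write $n=n_1n_2$ with $\operatorname{rad}(n_1)\mid\operatorname{ord}(a)$ and $\gcd(n_2,\operatorname{ord}(a))=1$, where $\operatorname{rad}$ denotes the product of the distinct prime divisors. Let $w$ be the multiplicative order of $q$ modulo $\operatorname{rad}(n)$; put $s:=w$ if $4\nmid n$ or $q^w\equiv1\pmod 4$, and $s:=2w$ otherwise. For $t\ge1$ put $$d_1^{(t)}:=\gcd\Bigl(n_1,\frac{q^t-1}{\operatorname{ord}(a)}\Bigr),\qquad d_2^{(t)}:=\gcd(n_2,q^t-1).$$ Put $s_1:=d_1^{(s)}/d_1^{(1)}$ if $4\nmid d_1^{(s)}$ or $q\equiv1\pmod4$, and $s_1:=2d_1^{(s)}/d_1^{(2)}$ otherwise. For a non-negative integer $i$ let $t_i$ be the least positive integer $t$ such that $d_2^{(s)}/d_2^{(t)}$ is an integer dividing $i$, and let $c_i:=\operatorname{lcm}(t_i,s_1)$. Then there is $b\in\mathbb F_{q^s}$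 with $b^{d_1^{(s)}}=a$, and $\mathbb F_{q^s}$ contains primitive $d_1^{(s)}$-th and $d_2^{(s)}$-th roots of unity. Fix any such $b$ and any such primitive roots of unity $\zeta_{d_1^{(s)}},\zeta_{d_2^{(s)}}\in\mathbb F_{q^s}$. On $\{0,\dots,d_1^{(s)}-1\}$ let $j\sim\tilde j$ if and only if $\zeta_{d_1^{(s)}}^{\tilde j}=\zeta_{d_1^{(s)}}^{jq^m}b^{q^m-1}$ for some integer $0\le m\le s_1-1$; this is an equivalence relation. Let $J\subseteq\{0,\dots,d_1^{(s)}-1\}$ be a complete set of representatives of its classes, and let $I\subseteq\{0,\dots,d_2^{(s)}-1\}$ be a complete set of representatives of the $q$-cyclotomic cosets $\{iq^u\bmod d_2^{(s)}:u\ge0\}$ modulo $d_2^{(s)}$. Let $r$ be a positive integer with $r=1$ if $a=1$, and $rn_2\equiv1\pmod{\operatorname{ord}(a)\,d_1^{(s)}}$ if $a\ne1$. Then $$X^n-a=\prod_{j\in J}\ \prod_{v\mid n_2/d_2^{(s)}}\ \prod_{\substack{i\in I\\ \gcd(i,v)=1}}\ \prod_{m=0}^{\gcd(t_i,s_1)-1}S_{(j,v,i,m)},$$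 where, with $\beta:=\zeta_{d_2^{(s)}}^{iq^m}\bigl(\zeta_{d_1^{(s)}}^{j}b\bigr)^{rv}$, $$S_{(j,v,i,m)}=\sum_{l=0}^{c_i}X^{\frac{n_1}{d_1^{(s)}}vl}\,(-1)^{c_i-l}\sum_{\substack{U\subseteq\{0,\dots,c_i-1\}\\|U|=c_i-l}}\ \prod_{u\in U}\beta^{q^u}.$$ For all occurring $(j,v,i,m)$ the polynomial $S_{(j,v,i,m)}$ has coefficients in $\mathbb F_q$, is monic and irreducible over $\mathbb F_q$, has degree $\frac{n_1}{d_1^{(s)}}\,v\,c_i$, and has order $\operatorname{ord}(a)\,n_1\,v\,\frac{d_2^{(s)}}{\gcd(i,d_2^{(s)})}$, where the order of a polynomial $f$ is the least positive integer $e$ with $f\mid X^e-1$. Moreover, $S_{(j,v,i,m)}$ is the $q$-spin of the binomial $h=X^{\frac{n_1}{d_1^{(s)}}v}-\beta$ over $\mathbb F_{q^s}$, that is, $S_{(j,v,i,m)}=\prod_{u=0}^{k-1}h^{(u)}$, where $h^{(u)}$ arises from $h$ by raising all coefficients to the power $q^u$, and $k$ is the degree over $\mathbb F_q$ of the field generated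 by the coefficients of $h$. -/

import Mathlib

open Polynomial

namespace BinomialFactorization

/-- `w = ord_{rad(n)}(q)`, the multiplicative order of `q` modulo the radical of `n`. -/
noncomputable def baseDegree (q n : ℕ) : ℕ :=
  orderOf (q : ZMod (UniqueFactorizationMonoid.radical n))

open Classical in
/-- `s = w` if `4 ∤ n` or `q ^ w ≡ 1 (mod 4)`, and `s = 2 w` otherwise. -/
noncomputable def extDegree (q n : ℕ) : ℕ :=
  if ¬ 4 ∣ n ∨ q ^ baseDegree q n ≡ 1 [MOD 4] then baseDegree q n else 2 * baseDegree q n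

/-- `d₁^{(t)} = gcd(n₁, (q ^ t - 1) / e)`, where `e = ord(a)` divides `q - 1`. -/
def dOne (q e n₁ t : ℕ) : ℕ := Nat.gcd n₁ ((q ^ t - 1) / e)

/-- `d₂^{(t)} = gcd(n₂, q ^ t - 1)`. -/
def dTwo (q n₂ t : ℕ) : ℕ := Nat.gcd n₂ (q ^ t - 1)

open Classical in
/-- `s₁ = d₁^{(s)} / d₁^{(1)}` if `4 ∤ d₁^{(s)}` or `q ≡ 1 (mod 4)`, and
`s₁ = 2 d₁^{(s)} / d₁^{(2)}` otherwise. -/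
noncomputable def sOne (q e n₁ s : ℕ) : ℕ :=
  if ¬ 4 ∣ dOne q e n₁ s ∨ q ≡ 1 [MOD 4] then dOne q e n₁ s / dOne q e n₁ 1
  else 2 * dOne q e n₁ s / dOne q e n₁ 2

/-- `t_i`, the least positive `t` such that `d₂^{(s)} / d₂^{(t)}` is an integer dividing `i`.
(`d₂^{(t)}` need not divide `d₂^{(s)}` for every `t`, so integrality is spelled out.) -/
noncomputable def tMin (q n₂ s i : ℕ) : ℕ :=
  sInf {t : ℕ | 0 < t ∧ dTwo q n₂ t ∣ dTwo q n₂ s ∧ dTwo q n₂ s / dTwo q n₂ t ∣ i}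

/-- `c_i = lcm(t_i, s₁)`. -/
noncomputable def cDegree (q e n₁ n₂ s i : ℕ) : ℕ :=
  Nat.lcm (tMin q n₂ s i) (sOne q e n₁ s)

/-- The `q`-cyclotomic coset modulo `d` containing `i`. -/
def cyclotomicCoset (q d i : ℕ) : Set ℕ := {k | ∃ u : ℕ, k = (i * q ^ u) % d}

/-- `T` contains exactly one representative of every class of the relation `R` on
`{0, …, d - 1}`. -/
def IsRepSystem (R : ℕ → ℕ → Prop) (d : ℕ) (T : Finset ℕ) : Prop :=
  T ⊆ Finset.range d ∧ ∀ j < d, ∃! k, k ∈ T ∧ R j k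

/-- A complete set of representatives of the `q`-cyclotomic cosets modulo `d`. -/
def IsCyclotomicRepSystem (q d : ℕ) (T : Finset ℕ) : Prop :=
  IsRepSystem (fun i k => k ∈ cyclotomicCoset q d i) d T

/-- The relation `j ∼ k` given by `ζ ^ k = ζ ^ (j q ^ m) b ^ (q ^ m - 1)` for some
`0 ≤ m ≤ s₁ - 1`. -/
def FrobRel {L : Type*} [Field L] (q s₁ : ℕ) (ζ b : L) (j k : ℕ) : Prop :=
  ∃ m < s₁, ζ ^ k = ζ ^ (j * q ^ m) * b ^ (q ^ m - 1)

/-- `e` is the order of `f`: the least positive integer with `f ∣ X ^ e - 1`. -/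
def HasOrder {F : Type*} [Field F] (f : F[X]) (e : ℕ) : Prop :=
  IsLeast {k : ℕ | 0 < k ∧ f ∣ X ^ k - 1} e

/-- The degree over `F` of the field generated by the coefficients of `h`. -/
noncomputable def coeffDegree (F : Type*) {L : Type*} [Field F] [Field L] [Algebra F L]
    (h : L[X]) : ℕ :=
  Module.finrank F (IntermediateField.adjoin F (Set.range h.coeff))

/-- `h^{(u)}`: every coefficient of `h` is raised to the power `q ^ u`. -/
noncomputable def frobTwist {L : Type*} [Field L] (q u : ℕ) (h : L[X]) : L[X] :=
  h.sum fun k c => monomial k (c ^ q ^ u)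

/-- The `q`-spin of `h`, where `q` is the number of elements of the finite field `F`. -/
noncomputable def qSpin (F : Type*) {L : Type*} [Field F] [Fintype F] [Field L] [Algebra F L]
    (h : L[X]) : L[X] :=
  ∏ u ∈ Finset.range (coeffDegree F h), frobTwist (Fintype.card F) u h

/-- The polynomial
`∑_{l = 0}^{c} X ^ (N l) (-1) ^ (c - l) ∑_{U ⊆ {0, …, c - 1}, |U| = c - l} ∏_{u ∈ U} β ^ (q ^ u)`. -/
noncomputable def explicitFactor {L : Type*} [Field L] (q N c : ℕ) (β : L) : L[X] :=
  ∑ l ∈ Finset.range (c + 1), X ^ (N * l) *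
    ((-1) ^ (c - l) * C (∑ U ∈ Finset.powersetCard (c - l) (Finset.range c),
      ∏ u ∈ U, β ^ q ^ u))

/-- The constant `ζ₂ ^ (i q ^ m) (ζ₁ ^ j b) ^ (r v)`. -/
def rootConst {L : Type*} [Field L] (q r : ℕ) (ζ₁ ζ₂ b : L) (j v i m : ℕ) : L :=
  ζ₂ ^ (i * q ^ m) * (ζ₁ ^ j * b) ^ (r * v)

end BinomialFactorization

open BinomialFactorization

/-! Write `D₁`, `D₂` for `d₁^{(s)}`, `d₂^{(s)}` and `N` for `n₁ / D₁ * v`. Let `x` be a root of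
`X ^ n - a`. As `r` inverts `n₂` modulo `ord(a) D₁`, the order of `ζ₁ ^ k * b`, the element
`z = x ^ (n₁ / D₁) / (ζ₁ ^ k * b) ^ r` is an `n₂`-th root of unity for a suitable `k`. If `v` is the
order of `z ^ D₂`, then `z ^ v = ζ₂ ^ l` with `l` coprime to `v`, so that `x ^ N = β` with
`β = ζ₂ ^ l * (ζ₁ ^ k * b) ^ (r * v)`. This `β` has order `M = ord(a) D₁ D₂ / gcd(l, D₂)`, hence
degree `c_l` over `F`, which is the least `c` with `M ∣ q ^ c - 1` by lifting the exponent.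

By Serret's criterion `X ^ N - β` is irreducible over the field with `q ^ c_l` elements, that is, a
root of it has order `N M` and degree `N c_l` over `F`. So the minimal polynomial of `x` over `F` is
that of `β` evaluated at `X ^ N`, and over `L` it splits into the twists of `X ^ N - β`. Its order
determines `v`, and for fixed `v` such polynomials correspond to the Frobenius orbits of the
constants `β`: an orbit of `ζ₁ ^ j * b`, of size `s₁`, and an orbit of `ζ₂ ^ i`, of size `t_i`, give
`gcd(t_i, s₁)` orbits on their product. -/

namespace BinomialFactorization

section Arithmetic

theorem pow_sub_one_ne_zero {Q k : ℕ} (hQ : 1 < Q) (hk : k ≠ 0) : Q ^ k - 1 ≠ 0 := by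
  have := Nat.one_lt_pow hk hQ
  omega

theorem four_dvd_pow_sub_one_iff {Q k : ℕ} (hQ : Q % 4 = 3) : 4 ∣ Q ^ k - 1 ↔ 2 ∣ k := by
  have hpos : 1 ≤ Q ^ k := Nat.one_le_pow _ _ (by omega)
  rcases Nat.even_or_odd' k with ⟨m, rfl | rfl⟩
  · have : Q ^ (2 * m) % 4 = 1 := by simp [pow_mul, Nat.pow_mod, hQ]
    omega
  · have : Q ^ (2 * m + 1) % 4 = 3 := by simp [pow_succ, Nat.mul_mod, pow_mul, Nat.pow_mod, hQ]
    omega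

theorem padicValNat_two_eq_one {m : ℕ} (h2 : 2 ∣ m) (h4 : ¬ 4 ∣ m) : padicValNat 2 m = 1 := by
  have hm : m ≠ 0 := by rintro rfl; exact h4 (dvd_zero 4)
  refine le_antisymm ?_ (one_le_padicValNat_of_dvd hm h2)
  by_contra h
  exact h4 ((padicValNat_dvd_iff_le (p := 2) (n := 2) hm).2 (by omega))

theorem padicValNat_two_pow_sub_one {Q k : ℕ} (hQ : 1 < Q) (h4 : 4 ∣ Q - 1) (hk : k ≠ 0) :
    padicValNat 2 (Q ^ k - 1) = padicValNat 2 (Q - 1) + padicValNat 2 k := by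
  have cast_pow_sub_one (l : ℕ) : (Q : ℤ) ^ l - 1 = (Q ^ l - 1 : ℕ) := by
    push_cast [Nat.one_le_pow l Q (by omega)]
    ring
  have lte := Int.two_pow_sub_pow' (x := (Q : ℤ)) (y := 1) k (by omega) (by omega)
  rw [one_pow, cast_pow_sub_one, ← pow_one (Q : ℤ), cast_pow_sub_one, pow_one,
    show (2 : ℤ) = (2 : ℕ) from rfl] at lte
  simp only [Int.natCast_emultiplicity] at lte
  rw [← padicValNat_eq_emultiplicity (pow_sub_one_ne_zero hQ hk),
    ← padicValNat_eq_emultiplicity (by omega), ← padicValNat_eq_emultiplicity hk] at lte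
  exact_mod_cast lte

theorem padicValNat_pow_sub_one {Q k p : ℕ} [hp : Fact p.Prime] (hQ : 1 < Q) (hpQ : p ∣ Q - 1)
    (h : p ≠ 2 ∨ 4 ∣ Q - 1) (hk : k ≠ 0) :
    padicValNat p (Q ^ k - 1) = padicValNat p (Q - 1) + padicValNat p k := by
  by_cases hp2 : p = 2
  · subst hp2
    exact padicValNat_two_pow_sub_one hQ (h.resolve_left (not_not.2 rfl)) hk
  · have hpQ' : ¬ p ∣ Q := fun h ↦ hp.out.not_dvd_one ((Nat.dvd_sub_iff_right hQ.le h).1 hpQ)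
    simpa using padicValNat.pow_sub_pow (hp.out.odd_of_ne_two hp2) hQ hpQ hpQ' hk

/-- The condition of Serret's criterion: if `β` has order `M` in the field with `Q` elements, then
`X ^ N - β` is irreducible over this field as soon as `SerretCondition Q M N` holds. -/
structure SerretCondition (Q M N : ℕ) : Prop where
  one_lt : 1 < Q
  dvd_sub_one : M ∣ Q - 1
  prime_dvd : ∀ p, p.Prime → p ∣ N → p ∣ M
  coprime : N.Coprime ((Q - 1) / M)
  four_dvd : 4 ∣ N → 4 ∣ Q - 1

namespace SerretCondition

variable {Q M N : ℕ}

theorem ne_zero_left (h : SerretCondition Q M N) : M ≠ 0 := by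
  rintro rfl
  have := h.one_lt
  have := zero_dvd_iff.1 h.dvd_sub_one
  omega

theorem ne_zero_right (h : SerretCondition Q M N) : N ≠ 0 := by
  rintro rfl
  obtain ⟨p, hMp, hp⟩ := Nat.exists_infinite_primes (M + 1)
  have := Nat.le_of_dvd (Nat.pos_of_ne_zero h.ne_zero_left) (h.prime_dvd p hp (dvd_zero p))
  omega

theorem padicValNat_eq (h : SerretCondition Q M N) {p : ℕ} [hp : Fact p.Prime] (hpN : p ∣ N) :
    padicValNat p M = padicValNat p (Q - 1) := by
  have hQ := h.one_lt
  obtain ⟨R, hR⟩ := h.dvd_sub_one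
  have hR0 : R ≠ 0 := by rintro rfl; omega
  have hcop := h.coprime
  rw [hR, Nat.mul_div_cancel_left _ (Nat.pos_of_ne_zero h.ne_zero_left)] at hcop
  have hpR : ¬ p ∣ R := fun hpR ↦ Nat.not_coprime_of_dvd_of_dvd hp.out.one_lt hpN hpR hcop
  rw [hR, padicValNat.mul h.ne_zero_left hR0, padicValNat.eq_zero_of_not_dvd hpR, add_zero]

theorem padicValNat_add_le_iff (h : SerretCondition Q M N) {p k : ℕ} [hp : Fact p.Prime]
    (hpN : p ∣ N) (hk : k ≠ 0) :
    padicValNat p N + padicValNat p M ≤ padicValNat p (Q ^ k - 1) ↔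
      padicValNat p N ≤ padicValNat p k := by
  have hQ := h.one_lt
  have hpQ : p ∣ Q - 1 := (h.prime_dvd p hp.out hpN).trans h.dvd_sub_one
  rw [h.padicValNat_eq hpN]
  by_cases lte : p ≠ 2 ∨ 4 ∣ Q - 1
  · have := padicValNat_pow_sub_one hQ hpQ lte hk
    omega
  · push Not at lte
    obtain ⟨rfl, h4⟩ := lte
    rw [padicValNat_two_eq_one hpN (mt h.four_dvd h4), padicValNat_two_eq_one hpQ h4,
      ← padicValNat_dvd_iff_le (pow_sub_one_ne_zero hQ hk), ← padicValNat_dvd_iff_le hk, pow_one]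
    exact four_dvd_pow_sub_one_iff (by omega)

theorem mul_dvd_pow_sub_one_iff (h : SerretCondition Q M N) (k : ℕ) :
    N * M ∣ Q ^ k - 1 ↔ N ∣ k := by
  rcases eq_or_ne k 0 with rfl | hk
  · simp
  have hM := h.ne_zero_left
  have hN := h.ne_zero_right
  have hQk := pow_sub_one_ne_zero h.one_lt hk
  have hMk : M ∣ Q ^ k - 1 := h.dvd_sub_one.trans (Nat.sub_one_dvd_pow_sub_one Q k)
  rw [← Nat.factorization_prime_le_iff_dvd hM hQk] at hMk
  rw [← Nat.factorization_prime_le_iff_dvd (mul_ne_zero hN hM) hQk,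
    ← Nat.factorization_prime_le_iff_dvd hN hk]
  refine forall₂_congr fun p hp ↦ ?_
  have : Fact p.Prime := ⟨hp⟩
  specialize hMk p hp
  simp only [Nat.factorization_def _ hp] at hMk ⊢
  rw [padicValNat.mul hN hM]
  by_cases hpN : p ∣ N
  · exact h.padicValNat_add_le_iff hpN hk
  · simp [padicValNat.eq_zero_of_not_dvd hpN, hMk]

/-- Only `4 ∣ Q - 1` is at stake. If `Q ≡ 3 (mod 4)` and `4 ∣ N`, then `l` is even, so
`8 ∣ Q ^ l - 1`; since `(Q ^ l - 1) / M` is odd, already `8 ∣ M ∣ Q - 1`. -/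
theorem of_pow {l : ℕ} (h : SerretCondition (Q ^ l) M N) (hM : M ∣ Q - 1) :
    SerretCondition Q M N where
  one_lt := by
    by_contra hQ
    exact absurd h.one_lt (pow_le_one' (not_lt.1 hQ) l).not_gt
  dvd_sub_one := hM
  prime_dvd := h.prime_dvd
  coprime := h.coprime.coprime_dvd_right (Nat.div_dvd_div hM (Nat.sub_one_dvd_pow_sub_one Q l))
  four_dvd h4N := by
    by_contra h4
    have h2M : 2 ∣ M := h.prime_dvd 2 Nat.prime_two (dvd_trans (by norm_num) h4N)
    have h2Q : 2 ∣ Q - 1 := h2M.trans hM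
    have h2l : 2 ∣ l := (four_dvd_pow_sub_one_iff (by omega)).1 (h.four_dvd h4N)
    have h8 : 8 ∣ M * ((Q ^ l - 1) / M) := by
      rw [Nat.mul_div_cancel' h.dvd_sub_one]
      exact (Nat.eight_dvd_sq_sub_one_of_odd (Nat.odd_iff.2 (by omega))).trans
        (Nat.pow_sub_one_dvd_pow_sub_one Q h2l)
    have hodd : Nat.Coprime 8 ((Q ^ l - 1) / M) :=
      (h.coprime.coprime_dvd_left (dvd_trans (by norm_num) h4N) : Nat.Coprime 2 _).pow_left 3
    exact h4 ((dvd_trans (by norm_num) (hodd.dvd_of_dvd_mul_right h8)).trans hM)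

end SerretCondition

theorem dvd_pow_sub_one_iff_orderOf_dvd {q M : ℕ} (hq : 0 < q) (k : ℕ) :
    M ∣ q ^ k - 1 ↔ orderOf (q : ZMod M) ∣ k := by
  rw [orderOf_dvd_iff_pow_eq_one, ← Nat.modEq_iff_dvd' (Nat.one_le_pow _ _ hq),
    ← ZMod.natCast_eq_natCast_iff]
  push_cast
  exact eq_comm

theorem orderOf_natCast_zmod_pos {q M : ℕ} (h : q.Coprime M) : 0 < orderOf (q : ZMod M) := by
  rw [← ZMod.coe_unitOfCoprime q h, orderOf_units]
  exact orderOf_pos _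

theorem div_gcd_dvd (i D : ℕ) : D / i.gcd D ∣ D :=
  Nat.div_dvd_of_dvd (Nat.gcd_dvd_right _ _)

theorem div_gcd_dvd_iff {D : ℕ} (hD : D ≠ 0) (i T : ℕ) : D / i.gcd D ∣ T ↔ D ∣ i * T := by
  rw [Nat.div_dvd_iff_dvd_mul (Nat.gcd_dvd_right i D)
    (Nat.gcd_pos_of_pos_right i (Nat.pos_of_ne_zero hD)), Nat.gcd_comm]
  exact dvd_gcd_mul_iff_dvd_mul

theorem dTwo_ne_zero {q n₂ t : ℕ} (hn₂ : n₂ ≠ 0) : dTwo q n₂ t ≠ 0 :=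
  Nat.gcd_ne_zero_left hn₂

theorem dTwo_eq_gcd_of_dvd {q n₂ s t : ℕ} (h : dTwo q n₂ t ∣ dTwo q n₂ s) :
    dTwo q n₂ t = (q ^ t - 1).gcd (dTwo q n₂ s) :=
  Nat.dvd_antisymm (Nat.dvd_gcd (Nat.gcd_dvd_right _ _) h)
    (Nat.dvd_gcd ((Nat.gcd_dvd_right _ _).trans (Nat.gcd_dvd_left _ _)) (Nat.gcd_dvd_left _ _))

theorem tMin_eq_orderOf {q n₂ s i : ℕ} (hq : 0 < q) (hn₂ : n₂ ≠ 0) (hcop : n₂.Coprime q) :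
    tMin q n₂ s i = orderOf (q : ZMod (dTwo q n₂ s / i.gcd (dTwo q n₂ s))) := by
  have hD : dTwo q n₂ s ≠ 0 := dTwo_ne_zero hn₂
  set D := dTwo q n₂ s
  have hMq : q.Coprime (D / i.gcd D) :=
    (hcop.coprime_dvd_left ((div_gcd_dvd i D).trans (Nat.gcd_dvd_left _ _))).symm
  set o := orderOf (q : ZMod (D / i.gcd D))
  have div_dTwo_dvd_iff {t : ℕ} (ht : dTwo q n₂ t ∣ D) : D / dTwo q n₂ t ∣ i ↔ o ∣ t := by
    rw [dTwo_eq_gcd_of_dvd ht, div_gcd_dvd_iff hD, mul_comm, ← div_gcd_dvd_iff hD,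
      dvd_pow_sub_one_iff_orderOf_dvd hq]
  have hos : o ∣ s :=
    (dvd_pow_sub_one_iff_orderOf_dvd hq s).1 ((div_gcd_dvd i D).trans (Nat.gcd_dvd_right _ _))
  have hoD : dTwo q n₂ o ∣ D :=
    Nat.gcd_dvd_gcd_of_dvd_right _ (Nat.pow_sub_one_dvd_pow_sub_one q hos)
  refine IsLeast.csInf_eq
    ⟨⟨orderOf_natCast_zmod_pos hMq, hoD, (div_dTwo_dvd_iff hoD).2 dvd_rfl⟩, ?_⟩
  rintro t ⟨ht, htD, hti⟩
  exact Nat.le_of_dvd ht ((div_dTwo_dvd_iff htD).1 hti)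

theorem odd_of_coprime_of_two_dvd {q n : ℕ} (hcop : n.Coprime q) (h : 2 ∣ n) : Odd q :=
  Nat.coprime_two_left.1 (hcop.coprime_dvd_left h)

theorem extDegree_pos {q n : ℕ} (hcop : n.Coprime q) : 0 < extDegree q n := by
  have : 0 < baseDegree q n := orderOf_natCast_zmod_pos
    (hcop.coprime_dvd_left UniqueFactorizationMonoid.radical_dvd_self).symm
  unfold extDegree
  split_ifs <;> omega

theorem prime_dvd_pow_extDegree_sub_one {q n p : ℕ} (hq : 0 < q) (hn : n ≠ 0) (hp : p.Prime)
    (hpn : p ∣ n) : p ∣ q ^ extDegree q n - 1 := by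
  have hdvd : baseDegree q n ∣ extDegree q n := by
    unfold extDegree
    split_ifs
    exacts [dvd_rfl, dvd_mul_left _ _]
  exact ((UniqueFactorizationMonoid.dvd_radical_iff_of_irreducible hp hn).2 hpn).trans
    ((dvd_pow_sub_one_iff_orderOf_dvd hq _).2 hdvd)

theorem four_dvd_pow_extDegree_sub_one {q n : ℕ} (hcop : n.Coprime q) (h4 : 4 ∣ n) :
    4 ∣ q ^ extDegree q n - 1 := by
  have hodd := odd_of_coprime_of_two_dvd hcop (dvd_trans (by norm_num) h4)
  unfold extDegree
  split_ifs with h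
  · exact (Nat.modEq_iff_dvd' (Nat.one_le_pow _ _ hodd.pos)).1
      (h.resolve_left (not_not.2 h4)).symm
  · rw [mul_comm, pow_mul]
    exact dvd_trans (by norm_num) (Nat.eight_dvd_sq_sub_one_of_odd hodd.pow)

theorem coprime_mul_of_prime_dvd {m e D : ℕ} (h : m.Coprime e)
    (hD : ∀ p, p.Prime → p ∣ D → p ∣ e) : m.Coprime (e * D) :=
  h.mul_right (Nat.coprime_of_dvd fun p hp hpm hpD ↦
    Nat.not_coprime_of_dvd_of_dvd hp.one_lt hpm (hD p hp hpD) h)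

theorem gcd_mul_div_gcd {v i D : ℕ} (hiv : i.Coprime v) :
    (v * (D / i.gcd D)).gcd D = D / i.gcd D := by
  have hco : v.Coprime (i.gcd D) := (hiv.coprime_dvd_left (Nat.gcd_dvd_left _ _)).symm
  calc (v * (D / i.gcd D)).gcd D
      = (D / i.gcd D * v).gcd (D / i.gcd D * i.gcd D) := by
        rw [Nat.div_mul_cancel (Nat.gcd_dvd_right i D), mul_comm v]
    _ = D / i.gcd D := by rw [Nat.gcd_mul_left, hco, mul_one]

theorem eq_of_mul_div_gcd_eq {v v' i i' D : ℕ} (hD : D ≠ 0) (hiv : i.Coprime v)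
    (hiv' : i'.Coprime v') (h : v * (D / i.gcd D) = v' * (D / i'.gcd D)) : v = v' := by
  have hdiv : D / i.gcd D = D / i'.gcd D := by
    rw [← gcd_mul_div_gcd hiv, h, gcd_mul_div_gcd hiv']
  rw [hdiv] at h
  exact Nat.eq_of_mul_eq_mul_right
    (Nat.pos_of_ne_zero (ne_zero_of_dvd_ne_zero hD (div_gcd_dvd i' D))) h

end Arithmetic

/-- The numerical data of the factorization of `X ^ (n₁ n₂) - a`, where `q` is the number of
elements of the base field, `e` is the order of `a`, and `Dᵢ` is `dᵢ^{(s)}`. -/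
structure Parameters (q e n₁ n₂ s D₁ D₂ s₁ : ℕ) : Prop where
  one_lt : 1 < q
  dvd_sub_one : e ∣ q - 1
  coprime_q : (n₁ * n₂).Coprime q
  radical_dvd : UniqueFactorizationMonoid.radical n₁ ∣ e
  coprime_e : n₂.Coprime e
  s_eq : s = extDegree q (n₁ * n₂)
  D₁_eq : D₁ = dOne q e n₁ s
  D₂_eq : D₂ = dTwo q n₂ s
  s₁_eq : s₁ = sOne q e n₁ s

namespace Parameters

variable {q e n₁ n₂ s D₁ D₂ s₁ : ℕ} (P : Parameters q e n₁ n₂ s D₁ D₂ s₁)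
include P

theorem ne_zero : n₁ * n₂ ≠ 0 := fun h ↦
  P.one_lt.ne' (by simpa [h] using P.coprime_q)

theorem n₁_ne_zero : n₁ ≠ 0 := left_ne_zero_of_mul P.ne_zero

theorem n₂_ne_zero : n₂ ≠ 0 := right_ne_zero_of_mul P.ne_zero

theorem e_ne_zero : e ≠ 0 := by
  rintro rfl
  have := P.one_lt
  have := zero_dvd_iff.1 P.dvd_sub_one
  omega

theorem dOne_ne_zero (t : ℕ) : dOne q e n₁ t ≠ 0 :=
  Nat.gcd_ne_zero_left P.n₁_ne_zero

theorem D₁_dvd : D₁ ∣ n₁ := by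
  rw [P.D₁_eq]
  exact Nat.gcd_dvd_left _ _

theorem D₂_dvd : D₂ ∣ n₂ := by
  rw [P.D₂_eq]
  exact Nat.gcd_dvd_left _ _

theorem D₁_ne_zero : D₁ ≠ 0 :=
  ne_zero_of_dvd_ne_zero P.n₁_ne_zero P.D₁_dvd

theorem D₂_ne_zero : D₂ ≠ 0 :=
  ne_zero_of_dvd_ne_zero P.n₂_ne_zero P.D₂_dvd

theorem div_D₂_ne_zero : n₂ / D₂ ≠ 0 :=
  (Nat.div_ne_zero_iff_of_dvd P.D₂_dvd).2 ⟨P.n₂_ne_zero, P.D₂_ne_zero⟩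

theorem s_pos : 0 < s := by
  rw [P.s_eq]
  exact extDegree_pos P.coprime_q

theorem prime_dvd_e {p : ℕ} (hp : p.Prime) (h : p ∣ n₁) : p ∣ e :=
  ((UniqueFactorizationMonoid.dvd_radical_iff_of_irreducible hp P.n₁_ne_zero).2 h).trans
    P.radical_dvd

theorem prime_dvd_D₂ {p : ℕ} (hp : p.Prime) (h : p ∣ n₂) : p ∣ D₂ := by
  rw [P.D₂_eq]
  refine Nat.dvd_gcd h ?_
  rw [P.s_eq]
  exact prime_dvd_pow_extDegree_sub_one (by have := P.one_lt; omega) P.ne_zero hp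
    (h.trans (dvd_mul_left _ _))

theorem e_dvd_pow_sub_one (t : ℕ) : e ∣ q ^ t - 1 :=
  P.dvd_sub_one.trans (Nat.sub_one_dvd_pow_sub_one q t)

theorem mul_dOne_dvd_pow_sub_one (t : ℕ) : e * dOne q e n₁ t ∣ q ^ t - 1 :=
  (Nat.dvd_div_iff_mul_dvd (P.e_dvd_pow_sub_one t)).1 (Nat.gcd_dvd_right _ _)

theorem mul_D₁_dvd_pow_sub_one : e * D₁ ∣ q ^ s - 1 := by
  rw [P.D₁_eq]
  exact P.mul_dOne_dvd_pow_sub_one s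

theorem D₂_dvd_pow_sub_one : D₂ ∣ q ^ s - 1 := by
  rw [P.D₂_eq]
  exact Nat.gcd_dvd_right _ _

theorem dOne_dvd_D₁ {u : ℕ} (hu : u ∣ s) : dOne q e n₁ u ∣ D₁ := by
  rw [P.D₁_eq]
  exact Nat.gcd_dvd_gcd_of_dvd_right _
    (Nat.div_dvd_div (P.e_dvd_pow_sub_one u) (Nat.pow_sub_one_dvd_pow_sub_one q hu))

theorem coprime_div_dOne (t : ℕ) :
    (n₁ / dOne q e n₁ t).Coprime ((q ^ t - 1) / (e * dOne q e n₁ t)) := by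
  rw [← Nat.div_div_eq_div_mul]
  exact Nat.coprime_div_gcd_div_gcd (Nat.pos_of_ne_zero (P.dOne_ne_zero t))

theorem coprime_div_D₂ : (n₂ / D₂).Coprime ((q ^ s - 1) / D₂) := by
  have hD₂ := P.D₂_ne_zero
  rw [P.D₂_eq] at hD₂ ⊢
  exact Nat.coprime_div_gcd_div_gcd (Nat.pos_of_ne_zero hD₂)

theorem four_dvd (h : 4 ∣ n₁ * n₂) : 4 ∣ q ^ s - 1 := by
  rw [P.s_eq]
  exact four_dvd_pow_extDegree_sub_one P.coprime_q h

theorem serretCondition_dOne {u : ℕ} (hu : u ≠ 0) (hus : u ∣ s) (h4 : 4 ∣ D₁ → 4 ∣ q ^ u - 1) :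
    SerretCondition (q ^ u) (e * dOne q e n₁ u) (D₁ / dOne q e n₁ u) where
  one_lt := Nat.one_lt_pow hu P.one_lt
  dvd_sub_one := P.mul_dOne_dvd_pow_sub_one u
  prime_dvd _ hp hpN := (P.prime_dvd_e hp
    (hpN.trans ((Nat.div_dvd_of_dvd (P.dOne_dvd_D₁ hus)).trans P.D₁_dvd))).mul_right _
  coprime := (P.coprime_div_dOne u).coprime_dvd_left
    (Nat.div_dvd_div (P.dOne_dvd_D₁ hus) P.D₁_dvd)
  four_dvd h := h4 (h.trans (Nat.div_dvd_of_dvd (P.dOne_dvd_D₁ hus)))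

theorem mul_D₁_dvd_pow_pow_sub_one_iff {u : ℕ} (hu : u ≠ 0) (hus : u ∣ s)
    (h4 : 4 ∣ D₁ → 4 ∣ q ^ u - 1) (k : ℕ) :
    e * D₁ ∣ (q ^ u) ^ k - 1 ↔ D₁ / dOne q e n₁ u ∣ k := by
  rw [← (P.serretCondition_dOne hu hus h4).mul_dvd_pow_sub_one_iff, mul_left_comm,
    Nat.div_mul_cancel (P.dOne_dvd_D₁ hus)]

theorem mul_D₁_dvd_pow_sub_one_iff (k : ℕ) : e * D₁ ∣ q ^ k - 1 ↔ s₁ ∣ k := by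
  rw [P.s₁_eq, sOne, ← P.D₁_eq]
  split_ifs with h
  · have h4 (h4D : 4 ∣ D₁) : 4 ∣ q ^ 1 - 1 := by
      rw [pow_one]
      exact (Nat.modEq_iff_dvd' P.one_lt.le).1 (h.resolve_left (not_not.2 h4D)).symm
    simpa using P.mul_D₁_dvd_pow_pow_sub_one_iff one_ne_zero (one_dvd s) h4 k
  · push Not at h
    obtain ⟨h4D, hq⟩ := h
    have h4n : 4 ∣ n₁ * n₂ := (h4D.trans P.D₁_dvd).mul_right n₂
    have hodd := odd_of_coprime_of_two_dvd P.coprime_q (dvd_trans (by norm_num) h4n)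
    have hq3 : q % 4 = 3 := by
      have : q % 4 ≠ 1 := hq
      have := Nat.odd_iff.1 hodd
      omega
    have h2s : 2 ∣ s := (four_dvd_pow_sub_one_iff hq3).1 (P.four_dvd h4n)
    have h4q : 4 ∣ q ^ 2 - 1 := dvd_trans (by norm_num) (Nat.eight_dvd_sq_sub_one_of_odd hodd)
    have even_of_dvd (h : e * D₁ ∣ q ^ k - 1) : 2 ∣ k :=
      (four_dvd_pow_sub_one_iff hq3).1 ((h4D.mul_left e).trans h)
    rw [Nat.mul_div_assoc _ (P.dOne_dvd_D₁ h2s)]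
    by_cases hk : 2 ∣ k
    · obtain ⟨l, rfl⟩ := hk
      rw [pow_mul, P.mul_D₁_dvd_pow_pow_sub_one_iff two_ne_zero h2s fun _ ↦ h4q,
        Nat.mul_dvd_mul_iff_left two_pos]
    · exact iff_of_false (mt even_of_dvd hk) fun h ↦ hk ((dvd_mul_right _ _).trans h)

theorem div_gcd_dvd_pow_sub_one_iff (i k : ℕ) :
    D₂ / i.gcd D₂ ∣ q ^ k - 1 ↔ tMin q n₂ s i ∣ k := by
  have hq : 0 < q := by have := P.one_lt; omega
  rw [tMin_eq_orderOf hq P.n₂_ne_zero P.coprime_q.coprime_mul_left, ← P.D₂_eq,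
    dvd_pow_sub_one_iff_orderOf_dvd hq]

theorem tMin_dvd_s (i : ℕ) : tMin q n₂ s i ∣ s :=
  (P.div_gcd_dvd_pow_sub_one_iff i s).1 ((div_gcd_dvd i D₂).trans P.D₂_dvd_pow_sub_one)

theorem s₁_dvd_s : s₁ ∣ s :=
  (P.mul_D₁_dvd_pow_sub_one_iff s).1 P.mul_D₁_dvd_pow_sub_one

theorem s₁_pos : 0 < s₁ :=
  Nat.pos_of_dvd_of_pos P.s₁_dvd_s P.s_pos

theorem coprime_mul_D₁ : n₂.Coprime (e * D₁) :=
  coprime_mul_of_prime_dvd P.coprime_e fun _ hp h ↦ P.prime_dvd_e hp (h.trans P.D₁_dvd)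

theorem coprime_mul_div_gcd (i : ℕ) : (e * D₁).Coprime (D₂ / i.gcd D₂) :=
  (P.coprime_mul_D₁.coprime_dvd_left ((div_gcd_dvd i D₂).trans P.D₂_dvd)).symm

theorem mul_dvd_pow_sub_one_iff (i k : ℕ) :
    e * D₁ * (D₂ / i.gcd D₂) ∣ q ^ k - 1 ↔ cDegree q e n₁ n₂ s i ∣ k := by
  rw [cDegree, ← P.s₁_eq, Nat.lcm_dvd_iff, ← P.div_gcd_dvd_pow_sub_one_iff,
    ← P.mul_D₁_dvd_pow_sub_one_iff]
  exact ⟨fun h ↦ ⟨(dvd_mul_left _ _).trans h, (dvd_mul_right _ _).trans h⟩,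
    fun h ↦ (P.coprime_mul_div_gcd i).mul_dvd_of_dvd_of_dvd h.2 h.1⟩

theorem cDegree_dvd_s (i : ℕ) : cDegree q e n₁ n₂ s i ∣ s :=
  Nat.lcm_dvd (P.tMin_dvd_s i) (P.s₁_eq ▸ P.s₁_dvd_s)

theorem dvd_n₂ {v : ℕ} (hv : v ∣ n₂ / D₂) : v ∣ n₂ :=
  hv.trans (Nat.div_dvd_of_dvd P.D₂_dvd)

theorem prime_dvd_div_gcd {v i p : ℕ} (hv : v ∣ n₂ / D₂) (hiv : i.Coprime v)
    (hp : p.Prime) (hpv : p ∣ v) : p ∣ D₂ / i.gcd D₂ := by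
  have hpD : p ∣ D₂ := P.prime_dvd_D₂ hp (hpv.trans (P.dvd_n₂ hv))
  rw [← Nat.div_mul_cancel (Nat.gcd_dvd_right i D₂)] at hpD
  refine (hp.dvd_mul.1 hpD).resolve_right fun h ↦ ?_
  exact Nat.not_coprime_of_dvd_of_dvd hp.one_lt (h.trans (Nat.gcd_dvd_left _ _)) hpv hiv

theorem coprime_exponent {v i : ℕ} (hv : v ∣ n₂ / D₂) (hiv : i.Coprime v) :
    (n₁ / D₁ * v).Coprime ((q ^ s - 1) / (e * D₁ * (D₂ / i.gcd D₂))) := by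
  have hM : e * D₁ * (D₂ / i.gcd D₂) ∣ q ^ s - 1 :=
    (P.mul_dvd_pow_sub_one_iff i s).2 (P.cDegree_dvd_s i)
  refine Nat.Coprime.mul_left ?_ ?_
  · have hco := P.coprime_div_dOne s
    rw [← P.D₁_eq] at hco
    exact hco.coprime_dvd_right (Nat.div_dvd_div_left hM (dvd_mul_right _ _))
  · have hv' : v.Coprime ((q ^ s - 1) / (D₂ / i.gcd D₂)) := by
      have hdiv : (q ^ s - 1) / (D₂ / i.gcd D₂) = (q ^ s - 1) / D₂ * i.gcd D₂ := by
        have hdvd : i.gcd D₂ ∣ (q ^ s - 1) / (D₂ / i.gcd D₂) := by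
          rw [Nat.dvd_div_iff_mul_dvd ((div_gcd_dvd i D₂).trans P.D₂_dvd_pow_sub_one),
            Nat.div_mul_cancel (Nat.gcd_dvd_right i D₂)]
          exact P.D₂_dvd_pow_sub_one
        rw [← Nat.div_div_div_eq_div (Nat.gcd_dvd_right i D₂) P.D₂_dvd_pow_sub_one,
          Nat.div_mul_cancel hdvd]
      rw [hdiv]
      exact (P.coprime_div_D₂.coprime_dvd_left hv).mul_right
        (hiv.symm.coprime_dvd_right (Nat.gcd_dvd_left _ _))
    exact hv'.coprime_dvd_right (Nat.div_dvd_div_left hM (dvd_mul_left _ _))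

theorem coprime_of_mem_cyclotomicCoset {v i l : ℕ} (hv : v ∣ n₂ / D₂)
    (hl : l ∈ cyclotomicCoset q D₂ i) (hlv : l.Coprime v) : i.Coprime v := by
  obtain ⟨u, rfl⟩ := hl
  refine Nat.coprime_of_dvd fun p hp hpi hpv ↦ ?_
  have hpD : p ∣ D₂ := P.prime_dvd_D₂ hp (hpv.trans (P.dvd_n₂ hv))
  exact Nat.not_coprime_of_dvd_of_dvd hp.one_lt
    ((Nat.dvd_mod_iff hpD).2 (hpi.mul_right _)) hpv hlv

theorem D₁_eq_one (he : e = 1) : D₁ = 1 := by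
  have hn₁ : n₁ ≤ 1 := Nat.radical_eq_one_iff.1 (Nat.dvd_one.1 (he ▸ P.radical_dvd))
  have := Nat.le_of_dvd (Nat.pos_of_ne_zero P.n₁_ne_zero) P.D₁_dvd
  have := P.D₁_ne_zero
  omega

theorem exponent_dvd {v : ℕ} (hv : v ∣ n₂ / D₂) : n₁ / D₁ * v ∣ n₁ * n₂ :=
  Nat.mul_dvd_mul (Nat.div_dvd_of_dvd P.D₁_dvd) (P.dvd_n₂ hv)

theorem exponent_ne_zero {v : ℕ} (hv : v ∣ n₂ / D₂) : n₁ / D₁ * v ≠ 0 :=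
  ne_zero_of_dvd_ne_zero P.ne_zero (P.exponent_dvd hv)

theorem serretCondition {v i : ℕ} (hv : v ∣ n₂ / D₂) (hiv : i.Coprime v) :
    SerretCondition (q ^ cDegree q e n₁ n₂ s i) (e * D₁ * (D₂ / i.gcd D₂)) (n₁ / D₁ * v) := by
  obtain ⟨l, hl⟩ := P.cDegree_dvd_s i
  have over_extension : SerretCondition (q ^ s) (e * D₁ * (D₂ / i.gcd D₂)) (n₁ / D₁ * v) :=
    { one_lt := Nat.one_lt_pow P.s_pos.ne' P.one_lt
      dvd_sub_one := (P.mul_dvd_pow_sub_one_iff i s).2 (P.cDegree_dvd_s i)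
      prime_dvd := fun p hp hpN ↦ (hp.dvd_mul.1 hpN).elim
        (fun h ↦ dvd_mul_of_dvd_left
          ((P.prime_dvd_e hp (h.trans (Nat.div_dvd_of_dvd P.D₁_dvd))).mul_right _) _)
        (fun h ↦ (P.prime_dvd_div_gcd hv hiv hp h).mul_left _)
      coprime := P.coprime_exponent hv hiv
      four_dvd := fun h ↦ P.four_dvd (h.trans (P.exponent_dvd hv)) }
  rw [hl, pow_mul] at over_extension
  exact over_extension.of_pow ((P.mul_dvd_pow_sub_one_iff i _).2 dvd_rfl)

end Parameters

section FiniteField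

variable (F : Type*) [Field F] [Fintype F] {L : Type*} [Field L] [Algebra F L]

theorem frobeniusAlgHom_pow_apply (k : ℕ) (x : L) :
    (FiniteField.frobeniusAlgHom F L ^ k) x = x ^ Fintype.card F ^ k := by
  rw [AlgHom.coe_pow, FiniteField.coe_frobeniusAlgHom, pow_iterate]

theorem pow_card_pow_injective (k : ℕ) :
    Function.Injective fun x : L ↦ x ^ Fintype.card F ^ k := by
  rw [← _root_.funext (frobeniusAlgHom_pow_apply F k)]
  exact (FiniteField.frobeniusAlgHom F L ^ k).toRingHom.injective

variable {F}

theorem pow_card_pow_eq_self_iff {x : L} (hx : IsIntegral F x) (d : ℕ) :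
    x ^ Fintype.card F ^ d = x ↔ (minpoly F x).natDegree ∣ d := by
  rw [(minpoly.irreducible hx).natDegree_dvd_iff_dvd_X_pow_card_pow_sub_X, minpoly.dvd_iff,
    Nat.card_eq_fintype_card]
  simp only [map_sub, map_pow, aeval_X, sub_eq_zero]

theorem pow_card_pow_eq_iff_modEq {x : L} {τ : ℕ} (hx : ∀ d, x ^ Fintype.card F ^ d = x ↔ τ ∣ d)
    (k l : ℕ) : x ^ Fintype.card F ^ k = x ^ Fintype.card F ^ l ↔ k ≡ l [MOD τ] := by
  wlog hkl : k ≤ l generalizing k l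
  · rw [eq_comm, this l k (by omega), Nat.ModEq.comm]
  obtain ⟨d, rfl⟩ := Nat.exists_eq_add_of_le hkl
  rw [Nat.modEq_iff_dvd' hkl, Nat.add_sub_cancel_left, ← hx, pow_add, mul_comm, pow_mul, eq_comm]
  exact (pow_card_pow_injective F k).eq_iff

theorem isConjRoot_iff_exists_eq_pow_card_pow [FiniteDimensional F L] {x y : L} :
    IsConjRoot F x y ↔ ∃ m, y = x ^ Fintype.card F ^ m := by
  have : Finite L := Module.finite_of_finite F
  rw [IsConjRoot.comm, isConjRoot_iff_exists_algEquiv]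
  constructor
  · rintro ⟨σ, rfl⟩
    obtain ⟨m, rfl⟩ := (FiniteField.bijective_frobeniusAlgEquivOfAlgebraic_pow F L).2 σ
    refine ⟨m, ?_⟩
    rw [AlgEquiv.coe_pow, FiniteField.coe_frobeniusAlgEquivOfAlgebraic_iterate]
  · rintro ⟨m, rfl⟩
    refine ⟨FiniteField.frobeniusAlgEquivOfAlgebraic F L ^ m, ?_⟩
    rw [AlgEquiv.coe_pow, FiniteField.coe_frobeniusAlgEquivOfAlgebraic_iterate]

theorem map_minpoly_eq_prod {β : L} (hβ : IsIntegral F β) :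
    (minpoly F β).map (algebraMap F L) =
      ∏ u ∈ Finset.range (minpoly F β).natDegree, (X - C (β ^ Fintype.card F ^ u)) := by
  have conjugates_ne : Set.InjOn (fun u ↦ β ^ Fintype.card F ^ u)
      (Finset.range (minpoly F β).natDegree) := fun u hu u' hu' h ↦
    Nat.ModEq.eq_of_lt_of_lt
      ((pow_card_pow_eq_iff_modEq (pow_card_pow_eq_self_iff hβ) u u').1 h)
      (Finset.mem_range.1 hu) (Finset.mem_range.1 hu')
  have isRoot_conjugate (u : ℕ) :
      ((minpoly F β).map (algebraMap F L)).IsRoot (β ^ Fintype.card F ^ u) := by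
    rw [IsRoot.def, eval_map_algebraMap, ← frobeniusAlgHom_pow_apply, aeval_algHom_apply,
      minpoly.aeval, map_zero]
  refine (eq_of_monic_of_dvd_of_natDegree_le (monic_prod_of_monic _ _ fun u _ ↦ monic_X_sub_C _)
    ((minpoly.monic hβ).map _) (Finset.prod_dvd_of_coprime ?_ fun u _ ↦ ?_) ?_)
  · exact fun u hu u' hu' hne ↦ isCoprime_X_sub_C_of_isUnit_sub
      (sub_ne_zero.2 fun h ↦ hne (conjugates_ne hu hu' h)).isUnit
  · exact dvd_iff_isRoot.2 (isRoot_conjugate u)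
  · rw [natDegree_map, natDegree_prod_of_monic _ _ fun u _ ↦ monic_X_sub_C _]
    simp only [natDegree_X_sub_C, Finset.sum_const, Finset.card_range, smul_eq_mul, mul_one, le_rfl]

theorem map_expand_minpoly_eq_prod (N : ℕ) {β : L} (hβ : IsIntegral F β) :
    (expand F N (minpoly F β)).map (algebraMap F L) =
      ∏ u ∈ Finset.range (minpoly F β).natDegree, (X ^ N - C (β ^ Fintype.card F ^ u)) := by
  simp only [map_expand, map_minpoly_eq_prod hβ, map_prod, map_sub, expand_X, expand_C]

theorem explicitFactor_eq_prod {L : Type*} [Field L] (q N c : ℕ) (β : L) :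
    explicitFactor q N c β = ∏ u ∈ Finset.range c, (X ^ N - C (β ^ q ^ u)) := by
  classical
  rw [Finset.prod_sub, Finset.sum_powerset, explicitFactor, Finset.card_range,
    ← Finset.sum_range_reflect]
  refine Finset.sum_congr rfl fun l hl ↦ ?_
  have hl : l ≤ c := Nat.lt_succ_iff.1 (Finset.mem_range.1 hl)
  rw [Nat.add_sub_cancel, Nat.sub_sub_self hl, map_sum, Finset.mul_sum, Finset.mul_sum]
  refine Finset.sum_congr rfl fun U hU ↦ ?_
  obtain ⟨hUs, hUc⟩ := Finset.mem_powersetCard.1 hU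
  rw [Finset.prod_const, Finset.card_sdiff_of_subset hUs, Finset.card_range, hUc, map_prod, pow_mul]
  ring

theorem frobTwist_eq_map (u : ℕ) (h : L[X]) :
    frobTwist (Fintype.card F) u h =
      h.map (FiniteField.frobeniusAlgHom F L ^ u : L →ₐ[F] L).toRingHom := by
  rw [frobTwist, Polynomial.map, eval₂_eq_sum]
  simp only [RingHom.comp_apply, AlgHom.toRingHom_eq_coe, RingHom.coe_coe,
    frobeniusAlgHom_pow_apply, C_mul_X_pow_eq_monomial]

theorem adjoin_range_coeff_X_pow_sub_C {F L : Type*} [Field F] [Field L] [Algebra F L] {N : ℕ}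
    (hN : N ≠ 0) (β : L) :
    IntermediateField.adjoin F (Set.range (X ^ N - C β : L[X]).coeff) =
      IntermediateField.adjoin F {β} := by
  refine le_antisymm (IntermediateField.adjoin_le_iff.2 ?_)
    (IntermediateField.adjoin_simple_le_iff.2 ?_)
  · rintro _ ⟨k, rfl⟩
    simp only [coeff_sub, coeff_X_pow, coeff_C]
    refine sub_mem ?_ ?_ <;> split_ifs
    exacts [one_mem _, zero_mem _, IntermediateField.mem_adjoin_simple_self F β, zero_mem _]
  · have : (X ^ N - C β : L[X]).coeff 0 ∈
        IntermediateField.adjoin F (Set.range (X ^ N - C β : L[X]).coeff) :=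
      IntermediateField.subset_adjoin _ _ ⟨0, rfl⟩
    rw [coeff_sub, coeff_X_pow, coeff_C_zero, if_neg hN.symm, zero_sub] at this
    simpa only [neg_neg] using neg_mem this

theorem qSpin_X_pow_sub_C {N : ℕ} (hN : N ≠ 0) {β : L} (hβ : IsIntegral F β) :
    qSpin F (X ^ N - C β) =
      ∏ u ∈ Finset.range (minpoly F β).natDegree, (X ^ N - C (β ^ Fintype.card F ^ u)) := by
  rw [qSpin, coeffDegree, adjoin_range_coeff_X_pow_sub_C hN, IntermediateField.adjoin.finrank hβ]
  simp only [frobTwist_eq_map, Polynomial.map_sub, Polynomial.map_pow, map_X, map_C,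
    AlgHom.toRingHom_eq_coe, RingHom.coe_coe, frobeniusAlgHom_pow_apply]

end FiniteField

section Order

theorem orderOf_eq_mul_of_pow_eq {G : Type*} [Monoid G] {x y : G} {N : ℕ} (hN : N ≠ 0)
    (hy : 0 < orderOf y) (hx : x ^ N = y) (hrad : ∀ p, p.Prime → p ∣ N → p ∣ orderOf y) :
    orderOf x = N * orderOf y := by
  refine orderOf_eq_of_pow_and_pow_div_prime (Nat.mul_pos (Nat.pos_of_ne_zero hN) hy) ?_ ?_
  · rw [pow_mul, hx, pow_orderOf_eq_one]
  · intro p hp hpd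
    have hpM : p ∣ orderOf y := (hp.dvd_mul.1 hpd).elim (hrad p hp) id
    rw [Nat.mul_div_assoc _ hpM, pow_mul, hx]
    exact pow_ne_one_of_lt_orderOf
      (Nat.div_pos (Nat.le_of_dvd hy hpM) hp.pos).ne' (Nat.div_lt_self hy hp.one_lt)

theorem orderOf_algebraMap {F : Type*} (L : Type*) [Field F] [Field L] [Algebra F L] (a : F) :
    orderOf (algebraMap F L a) = orderOf a :=
  orderOf_injective (algebraMap F L : F →* L) (algebraMap F L).injective a

theorem pow_pow_eq_self_iff {G : Type*} [MonoidWithZero G] [IsRightCancelMulZero G] {x : G}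
    (hx : x ≠ 0) {q : ℕ} (hq : 0 < q) (d : ℕ) : x ^ q ^ d = x ↔ orderOf x ∣ q ^ d - 1 := by
  rw [orderOf_dvd_iff_pow_eq_one, ← Nat.sub_add_cancel (Nat.one_le_pow d q hq), pow_succ,
    Nat.add_sub_cancel]
  exact mul_eq_right₀ hx

theorem hasOrder_minpoly {F Ω : Type*} [Field F] [Field Ω] [Algebra F Ω] {x : Ω}
    (hx : 0 < orderOf x) : HasOrder (minpoly F x) (orderOf x) := by
  have dvd_iff (k : ℕ) : minpoly F x ∣ X ^ k - 1 ↔ orderOf x ∣ k := by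
    rw [minpoly.dvd_iff, orderOf_dvd_iff_pow_eq_one]
    simp [sub_eq_zero]
  exact ⟨⟨hx, (dvd_iff _).2 dvd_rfl⟩, fun k hk ↦ Nat.le_of_dvd hk.1 ((dvd_iff k).1 hk.2)⟩

theorem SerretCondition.orderOf_eq {G : Type*} [Monoid G] {x : G} {Q N : ℕ}
    (h : SerretCondition Q (orderOf (x ^ N)) N) : orderOf x = N * orderOf (x ^ N) :=
  orderOf_eq_mul_of_pow_eq h.ne_zero_right (Nat.pos_of_ne_zero h.ne_zero_left) rfl h.prime_dvd

theorem SerretCondition.expand_minpoly_eq {F Ω : Type*} [Field F] [Fintype F] [Field Ω]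
    [Algebra F Ω] {x : Ω} {N : ℕ}
    (h : SerretCondition (Fintype.card F ^ (minpoly F (x ^ N)).natDegree) (orderOf (x ^ N)) N) :
    expand F N (minpoly F (x ^ N)) = minpoly F x := by
  have hN : 0 < N := Nat.pos_of_ne_zero h.ne_zero_right
  have hord : orderOf x ≠ 0 := h.orderOf_eq ▸ mul_ne_zero h.ne_zero_right h.ne_zero_left
  have hx0 : x ≠ 0 := fun hx ↦ hord (hx ▸ orderOf_zero Ω)
  have hx : IsIntegral F x :=
    .of_pow (Nat.pos_of_ne_zero hord) (pow_orderOf_eq_one x ▸ isIntegral_one)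
  have hxN : IsIntegral F (x ^ N) := hx.pow N
  have degree_dvd : (minpoly F (x ^ N)).natDegree * N ∣ (minpoly F x).natDegree := by
    have hfix := (pow_card_pow_eq_self_iff hx _).2 dvd_rfl
    obtain ⟨k, hk⟩ := (pow_card_pow_eq_self_iff hxN (minpoly F x).natDegree).1
      (by rw [← pow_mul, mul_comm, pow_mul, hfix])
    rw [pow_pow_eq_self_iff hx0 Fintype.card_pos, h.orderOf_eq, hk, pow_mul,
      h.mul_dvd_pow_sub_one_iff] at hfix
    rw [hk]
    exact mul_dvd_mul_left _ hfix
  refine eq_of_monic_of_dvd_of_natDegree_le (minpoly.monic hx)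
    ((monic_expand_iff hN).2 (minpoly.monic hxN)) (minpoly.dvd F x ?_) ?_
  · rw [expand_aeval, minpoly.aeval]
  · rw [natDegree_expand]
    exact Nat.le_of_dvd (minpoly.natDegree_pos hx) degree_dvd

end Order

section Factor

variable {F L : Type*} [Field F] [Fintype F] [Field L] [Algebra F L]

namespace SerretCondition

variable {N : ℕ} {β : L}

theorem expand_minpoly_eq_of_pow_eq {Ω : Type*} [Field Ω] [Algebra F Ω] [Algebra L Ω]
    [IsScalarTower F L Ω]
    (h : SerretCondition (Fintype.card F ^ (minpoly F β).natDegree) (orderOf β) N) {x : Ω}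
    (hx : x ^ N = algebraMap L Ω β) :
    expand F N (minpoly F β) = minpoly F x ∧ orderOf x = N * orderOf β := by
  have hinj := (algebraMap L Ω).injective
  rw [← minpoly.algebraMap_eq hinj, ← orderOf_algebraMap Ω β, ← hx] at h ⊢
  exact ⟨h.expand_minpoly_eq, h.orderOf_eq⟩

theorem irreducible_and_hasOrder_expand_minpoly
    (h : SerretCondition (Fintype.card F ^ (minpoly F β).natDegree) (orderOf β) N) :
    Irreducible (expand F N (minpoly F β)) ∧
      HasOrder (expand F N (minpoly F β)) (N * orderOf β) := by
  obtain ⟨x, hx⟩ := IsAlgClosed.exists_pow_nat_eq (algebraMap L (AlgebraicClosure L) β)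
    (Nat.pos_of_ne_zero h.ne_zero_right)
  obtain ⟨hmin, hord⟩ := h.expand_minpoly_eq_of_pow_eq hx
  have hpos : 0 < orderOf x :=
    Nat.pos_of_ne_zero (hord ▸ mul_ne_zero h.ne_zero_right h.ne_zero_left)
  rw [hmin, ← hord]
  exact ⟨minpoly.irreducible (.of_pow hpos (pow_orderOf_eq_one x ▸ isIntegral_one)),
    hasOrder_minpoly hpos⟩

end SerretCondition

end Factor

section Coprime

theorem eq_of_pow_eq_pow_of_coprime {G : Type*} [Monoid G] {x y : G} {k l : ℕ}
    (h : k.Coprime l) (hx : x ^ k = 1) (hy : y ^ k = 1) (hxy : x ^ l = y ^ l) : x = y := by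
  obtain ⟨m, hk, hl⟩ := Nat.chineseRemainder h 1 0
  obtain ⟨d, rfl⟩ := (Nat.modEq_zero_iff_dvd).1 hl
  rw [← pow_one x, ← pow_eq_pow_of_modEq hk hx, pow_mul, hxy, ← pow_mul,
    pow_eq_pow_of_modEq hk hy, pow_one]

theorem eq_and_eq_of_mul_eq_mul_of_coprime {G : Type*} [CommMonoid G] {x x' y y' : G} {k l : ℕ}
    (h : k.Coprime l) (hx : x ^ k = 1) (hx' : x' ^ k = 1) (hy : y ^ l = 1) (hy' : y' ^ l = 1)
    (hxy : x * y = x' * y') : x = x' ∧ y = y' := by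
  constructor
  · refine eq_of_pow_eq_pow_of_coprime h hx hx' ?_
    simpa only [mul_pow, hy, hy', mul_one] using congrArg (· ^ l) hxy
  · refine eq_of_pow_eq_pow_of_coprime h.symm hy hy' ?_
    simpa only [mul_pow, hx, hx', one_mul] using congrArg (· ^ k) hxy

theorem exists_add_modEq_and_modEq {τ σ : ℕ} (hτ : τ ≠ 0) (μ κ : ℕ) :
    ∃ m < τ.gcd σ, ∃ u, m + u ≡ μ [MOD τ] ∧ u ≡ κ [MOD σ] := by
  have hG : 0 < τ.gcd σ := Nat.gcd_pos_of_pos_left _ (Nat.pos_of_ne_zero hτ)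
  have exists_add (g μ κ : ℕ) (hg : 0 < g) : ∃ m < g, m + κ ≡ μ [MOD g] := by
    obtain ⟨g, rfl⟩ := Nat.exists_eq_add_one.2 hg
    refine ⟨(μ + κ * g) % (g + 1), Nat.mod_lt _ hg, ((Nat.mod_modEq _ _).add_right κ).trans ?_⟩
    rw [add_assoc, ← Nat.mul_succ]
    exact Nat.add_mul_mod_self_right _ _ _
  obtain ⟨m, hm, hmκ⟩ := exists_add (τ.gcd σ) μ κ hG
  obtain ⟨u₀, -, hu₀⟩ := exists_add τ μ m (Nat.pos_of_ne_zero hτ)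
  rw [add_comm] at hu₀
  have compatible : u₀ ≡ κ [MOD τ.gcd σ] :=
    Nat.ModEq.add_left_cancel' m ((hu₀.of_dvd (Nat.gcd_dvd_left _ _)).trans hmκ.symm)
  obtain ⟨u, hu, hκ⟩ := Nat.chineseRemainder' compatible
  exact ⟨m, hm, u, (hu.add_left m).trans hu₀, hκ⟩

end Coprime

section RootsOfUnity

variable {K : Type*} [Field K] {ζ : K} {D : ℕ}

theorem orderOf_primitiveRoot_pow (hD : D ≠ 0) (hζ : IsPrimitiveRoot ζ D) (i : ℕ) :
    orderOf (ζ ^ i) = D / i.gcd D := by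
  rcases eq_or_ne i 0 with rfl | hi
  · simp [Nat.div_self (Nat.pos_of_ne_zero hD)]
  · rw [orderOf_pow' ζ hi, ← hζ.eq_orderOf, Nat.gcd_comm]

theorem exists_eq_primitiveRoot_pow_mul (hD : D ≠ 0) (hζ : IsPrimitiveRoot ζ D) {x c : K}
    (h : x ^ D = c ^ D) : ∃ k < D, x = ζ ^ k * c := by
  have hx := (mem_nthRoots (Nat.pos_of_ne_zero hD)).2 h
  rw [hζ.nthRoots_eq rfl, Multiset.mem_map] at hx
  obtain ⟨k, hk, rfl⟩ := hx
  exact ⟨k, Multiset.mem_range.1 hk, rfl⟩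

/- Take `v` to be the order of `z ^ D`: then `z ^ v` is a `D`-th root of unity, and a common prime
factor `p` of `l` and `v` would give `(z ^ D) ^ (v / p) = ζ ^ (l * D / p) = 1`. -/
theorem exists_pow_eq_primitiveRoot_pow {n : ℕ} (hn : n ≠ 0) (hD : D ∣ n)
    (hprime : ∀ p, p.Prime → p ∣ n → p ∣ D) (hζ : IsPrimitiveRoot ζ D) {z : K} (hz : z ^ n = 1) :
    ∃ v, v ∣ n / D ∧ ∃ l < D, l.Coprime v ∧ z ^ v = ζ ^ l := by
  have hD0 : D ≠ 0 := ne_zero_of_dvd_ne_zero hn hD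
  have : NeZero D := ⟨hD0⟩
  have hv : orderOf (z ^ D) ∣ n / D := orderOf_dvd_of_pow_eq_one (by
    rw [← pow_mul, Nat.mul_div_cancel' hD, hz])
  have hvn := hv.trans (Nat.div_dvd_of_dvd hD)
  obtain ⟨l, hl, hlz⟩ := hζ.eq_pow_of_pow_eq_one (ξ := z ^ orderOf (z ^ D)) (by
    rw [← pow_mul, mul_comm, pow_mul, pow_orderOf_eq_one])
  refine ⟨_, hv, l, hl, Nat.coprime_of_dvd fun p hp hpl hpv ↦ ?_, hlz.symm⟩
  have hpD := hprime p hp (hpv.trans hvn)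
  obtain ⟨l', rfl⟩ := hpl
  obtain ⟨D', hD'⟩ := hpD
  obtain ⟨v', hv'⟩ := hpv
  have hv0 : 0 < v' := Nat.pos_of_ne_zero fun h ↦
    ne_zero_of_dvd_ne_zero hn hvn (by rw [hv', h, mul_zero])
  have smaller : (z ^ D) ^ v' = 1 := calc
    (z ^ D) ^ v' = (z ^ orderOf (z ^ D)) ^ D' := by rw [hv', hD', ← pow_mul, ← pow_mul]; ring
    _ = (ζ ^ D) ^ l' := by rw [← hlz, hD', ← pow_mul, ← pow_mul]; ring
    _ = 1 := by rw [hζ.pow_eq_one, one_pow]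
  have := Nat.le_of_dvd hv0 (orderOf_dvd_of_pow_eq_one smaller)
  have := hp.two_le
  nlinarith

end RootsOfUnity

section Product

theorem eq_prod_of_forall_root {F ι : Type*} [Field F] (Ω : Type*) [Field Ω] [Algebra F Ω]
    [IsAlgClosed Ω] {f : F[X]} (hf : f.Monic) (hsep : f.Separable) {K : Finset ι} {S : ι → F[X]}
    (hmonic : ∀ k ∈ K, (S k).Monic) (hirr : ∀ k ∈ K, Irreducible (S k))
    (hdvd : ∀ k ∈ K, S k ∣ f) (hinj : Set.InjOn S K)
    (hroot : ∀ x : Ω, aeval x f = 0 → ∃ k ∈ K, aeval x (S k) = 0) : f = ∏ k ∈ K, S k := by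
  have pairwise_coprime : (K : Set ι).Pairwise (Function.onFun IsCoprime S) := by
    refine fun k hk l hl hne ↦ ((hirr k hk).coprime_iff_not_dvd).2 fun h ↦ hne (hinj hk hl ?_)
    exact eq_of_monic_of_associated (hmonic k hk) (hmonic l hl)
      ((hirr k hk).associated_of_dvd (hirr l hl) h)
  obtain ⟨g, hg⟩ := Finset.prod_dvd_of_coprime pairwise_coprime hdvd
  have hcop : IsCoprime (∏ k ∈ K, S k) g := (hg ▸ hsep).isCoprime
  have cofactor_isUnit : IsUnit g := by
    by_contra hunit
    obtain ⟨x, hx⟩ := IsAlgClosed.exists_aeval_eq_zero Ω g fun h ↦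
      hunit (isUnit_iff_degree_eq_zero.2 h)
    obtain ⟨k, hk, hkx⟩ := hroot x (by rw [hg, map_mul, hx, mul_zero])
    refine (aeval_ne_zero_of_isCoprime hcop x).elim (fun h ↦ h ?_) fun h ↦ h hx
    rw [map_prod, Finset.prod_eq_zero hk hkx]
  exact eq_of_monic_of_associated hf (monic_prod_of_monic _ _ hmonic)
    (hg ▸ associated_mul_unit_left _ _ cofactor_isUnit)

/-- The quadruples `(j, v, i, m)` that index the factors of the binomial, where `N` stands for
`n₂ / d₂^{(s)}` and `μ i` for `gcd(t_i, s₁)`. -/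
def indexSet (J I : Finset ℕ) (N : ℕ) (μ : ℕ → ℕ) : Finset (Σ _ : ℕ, Σ _ : ℕ, Σ _ : ℕ, ℕ) :=
  J.sigma fun _ ↦ N.divisors.sigma fun v ↦ (I.filter fun i ↦ i.Coprime v).sigma fun i ↦
    Finset.range (μ i)

theorem mem_indexSet {J I : Finset ℕ} {N : ℕ} (hN : N ≠ 0) {μ : ℕ → ℕ} {j v i m : ℕ} :
    ⟨j, v, i, m⟩ ∈ indexSet J I N μ ↔ j ∈ J ∧ v ∣ N ∧ (i ∈ I ∧ i.Coprime v) ∧ m < μ i := by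
  simp only [indexSet, Finset.mem_sigma, Nat.mem_divisors, Finset.mem_filter, Finset.mem_range,
    ne_eq, hN, not_false_eq_true, and_true]

theorem IsRepSystem.eq_of_rel {R : ℕ → ℕ → Prop} {d : ℕ} {T : Finset ℕ} (hT : IsRepSystem R d T)
    {j k : ℕ} (hj : j ∈ T) (hk : k ∈ T) (hjj : R j j) (hjk : R j k) : j = k :=
  (hT.2 j (Finset.mem_range.1 (hT.1 hj))).unique ⟨hj, hjj⟩ ⟨hk, hjk⟩

theorem natCast_ne_zero_of_coprime_card {F : Type*} [Field F] [Fintype F] {n : ℕ}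
    (h : n.Coprime (Fintype.card F)) : (n : F) ≠ 0 := by
  have := (Nat.isCoprime_iff_coprime.2 h).map (Int.castRingHom F)
  simpa [Nat.cast_card_eq_zero, isCoprime_zero_right] using this

end Product

section Existence

theorem exists_isPrimitiveRoot_of_dvd_card_sub_one {L : Type*} [Field L] [Finite L] {D : ℕ}
    (hD : D ∣ Nat.card L - 1) : ∃ ζ : L, IsPrimitiveRoot ζ D := by
  obtain ⟨g, hg⟩ := IsCyclic.exists_ofOrder_eq_natCard (α := Lˣ)
  obtain ⟨k, hk⟩ := hD
  rw [Nat.card_units] at hg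
  have hprim : IsPrimitiveRoot (g : L) (Nat.card L - 1) := by
    rw [← hg, ← orderOf_units]
    exact IsPrimitiveRoot.orderOf _
  exact ⟨_, hprim.pow (hg ▸ orderOf_pos g) (by rw [hk, mul_comm])⟩

theorem exists_pow_eq_of_orderOf_mul_dvd {L : Type*} [Field L] [Finite L] {a : L} {D : ℕ}
    (hD : orderOf a * D ∣ Nat.card L - 1) : ∃ b : L, b ^ D = a := by
  obtain ⟨ζ, hζ⟩ := exists_isPrimitiveRoot_of_dvd_card_sub_one hD
  have hord : 0 < orderOf a * D :=
    Nat.pos_of_dvd_of_pos hD (Nat.sub_pos_of_lt Finite.one_lt_card)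
  have : NeZero (orderOf a) := ⟨(Nat.pos_of_mul_pos_right hord).ne'⟩
  obtain ⟨i, -, hi⟩ := (hζ.pow hord (mul_comm _ _)).eq_pow_of_pow_eq_one (pow_orderOf_eq_one a)
  exact ⟨ζ ^ i, by rw [← hi, ← pow_mul, ← pow_mul, mul_comm]⟩

end Existence

/-- The factor `S_{(j,v,i,m)}`, with `N` standing for `n₁ / d₁^{(s)}`. It is defined directly
over `F`, as the minimal polynomial of the constant `β` of the binomial `X ^ (N v) - β`, evaluated
at `X ^ (N v)`. -/
noncomputable def spinFactor (F : Type*) {L : Type*} [Field F] [Fintype F] [Field L] [Algebra F L]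
    (N r : ℕ) (ζ₁ ζ₂ b : L) (j v i m : ℕ) : F[X] :=
  expand F (N * v) (minpoly F (rootConst (Fintype.card F) r ζ₁ ζ₂ b j v i m))

/-- The situation of the factorization of `X ^ (n₁ n₂) - a` over `F`: the parameters belong to
`q = |F|` and `e = ord(a)`, and the extension `L` of degree `s` carries a root `b` of
`X ^ D₁ - a` and primitive roots of unity `ζ₁`, `ζ₂` of orders `D₁`, `D₂`. -/
structure RootData {F L : Type*} [Field F] [Fintype F] [Field L] [Algebra F L] (a : F)
    (n₁ n₂ s D₁ D₂ s₁ : ℕ) (b ζ₁ ζ₂ : L) : Prop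
    extends Parameters (Fintype.card F) (orderOf a) n₁ n₂ s D₁ D₂ s₁ where
  finrank_eq : Module.finrank F L = s
  pow_eq : b ^ D₁ = algebraMap F L a
  isPrimitiveRoot₁ : IsPrimitiveRoot ζ₁ D₁
  isPrimitiveRoot₂ : IsPrimitiveRoot ζ₂ D₂

namespace RootData

variable {F L : Type*} [Field F] [Fintype F] [Field L] [Algebra F L] {a : F}
  {n₁ n₂ s D₁ D₂ s₁ r : ℕ} {b ζ₁ ζ₂ : L}

section

variable (R : RootData a n₁ n₂ s D₁ D₂ s₁ b ζ₁ ζ₂)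
include R

theorem finiteDimensional : FiniteDimensional F L :=
  .of_finrank_pos (R.finrank_eq ▸ R.s_pos)

theorem root_pow (j : ℕ) : (ζ₁ ^ j * b) ^ D₁ = algebraMap F L a := by
  rw [mul_pow, ← pow_mul, mul_comm j, pow_mul, R.isPrimitiveRoot₁.pow_eq_one, one_pow, one_mul,
    R.pow_eq]

theorem orderOf_root (j : ℕ) : orderOf (ζ₁ ^ j * b) = orderOf a * D₁ := by
  have hord := orderOf_algebraMap L a
  rw [mul_comm (orderOf a), ← hord]
  exact orderOf_eq_mul_of_pow_eq R.D₁_ne_zero (hord ▸ Nat.pos_of_ne_zero R.e_ne_zero)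
    (R.root_pow j) fun p hp h ↦ hord ▸ R.prime_dvd_e hp (h.trans R.D₁_dvd)

theorem root_pow_eq_one (j : ℕ) : (ζ₁ ^ j * b) ^ (orderOf a * D₁) = 1 := by
  rw [← R.orderOf_root j, pow_orderOf_eq_one]

theorem root_ne_zero (j : ℕ) : ζ₁ ^ j * b ≠ 0 :=
  left_ne_zero_of_mul (b := (ζ₁ ^ j * b) ^ (orderOf a * D₁ - 1)) <| by
    rw [mul_pow_sub_one (mul_ne_zero R.e_ne_zero R.D₁_ne_zero), R.root_pow_eq_one]
    exact one_ne_zero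

theorem root_pow_card_pow_eq_self_iff (j d : ℕ) :
    (ζ₁ ^ j * b) ^ Fintype.card F ^ d = ζ₁ ^ j * b ↔ s₁ ∣ d := by
  rw [pow_pow_eq_self_iff (R.root_ne_zero j) Fintype.card_pos, R.orderOf_root,
    R.mul_D₁_dvd_pow_sub_one_iff]

theorem primitiveRoot_pow_card_pow_eq_self_iff (i d : ℕ) :
    (ζ₂ ^ i) ^ Fintype.card F ^ d = ζ₂ ^ i ↔ tMin (Fintype.card F) n₂ s i ∣ d := by
  rw [pow_pow_eq_self_iff (pow_ne_zero _ (R.isPrimitiveRoot₂.ne_zero R.D₂_ne_zero))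
    Fintype.card_pos, orderOf_primitiveRoot_pow R.D₂_ne_zero R.isPrimitiveRoot₂,
    R.div_gcd_dvd_pow_sub_one_iff]

theorem isConjRoot_iff {x y : L} : IsConjRoot F x y ↔ ∃ m, y = x ^ Fintype.card F ^ m :=
  have := R.finiteDimensional
  isConjRoot_iff_exists_eq_pow_card_pow

theorem frobRel_iff (j k : ℕ) :
    FrobRel (Fintype.card F) s₁ ζ₁ b j k ↔ IsConjRoot F (ζ₁ ^ j * b) (ζ₁ ^ k * b) := by
  have hb : b ≠ 0 := right_ne_zero_of_mul (R.root_ne_zero 0)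
  have twist_iff (m : ℕ) :
      ζ₁ ^ k = ζ₁ ^ (j * Fintype.card F ^ m) * b ^ (Fintype.card F ^ m - 1) ↔
        ζ₁ ^ k * b = (ζ₁ ^ j * b) ^ Fintype.card F ^ m := by
    rw [← mul_left_inj' hb, mul_assoc, ← pow_succ,
      Nat.sub_add_cancel (Nat.one_le_pow _ _ Fintype.card_pos), pow_mul, mul_pow]
  simp only [R.isConjRoot_iff, FrobRel, twist_iff]
  refine ⟨fun ⟨m, _, hm⟩ ↦ ⟨m, hm⟩, fun ⟨m, hm⟩ ↦ ⟨m % s₁, Nat.mod_lt _ R.s₁_pos, ?_⟩⟩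
  rw [hm]
  exact (pow_card_pow_eq_iff_modEq (R.root_pow_card_pow_eq_self_iff j) _ _).2
    (Nat.mod_modEq _ _).symm

theorem equivalence_frobRel :
    Equivalence fun j k : Fin D₁ ↦ FrobRel (Fintype.card F) s₁ ζ₁ b j k := by
  simp only [R.frobRel_iff]
  exact ⟨fun _ ↦ .refl, .symm, .trans⟩

theorem mem_cyclotomicCoset_iff (i : ℕ) {k : ℕ} (hk : k < D₂) :
    k ∈ cyclotomicCoset (Fintype.card F) D₂ i ↔ IsConjRoot F (ζ₂ ^ i) (ζ₂ ^ k) := by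
  rw [R.isConjRoot_iff]
  refine exists_congr fun u ↦ ?_
  rw [← pow_mul, ← pow_mod_orderOf ζ₂ (i * _), ← R.isPrimitiveRoot₂.eq_orderOf]
  exact ⟨fun h ↦ h ▸ rfl, R.isPrimitiveRoot₂.pow_inj hk (Nat.mod_lt _ (by omega))⟩

theorem root_pow_mul (hr : r * n₂ ≡ 1 [MOD orderOf a * D₁]) (j : ℕ) :
    (ζ₁ ^ j * b) ^ (r * n₂) = ζ₁ ^ j * b := by
  rw [pow_eq_pow_of_modEq hr (R.root_pow_eq_one j), pow_one]

theorem coprime_mul (hr : r * n₂ ≡ 1 [MOD orderOf a * D₁]) {v : ℕ} (hv : v ∣ n₂ / D₂) :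
    (orderOf a * D₁).Coprime (r * v) := by
  have : (orderOf a * D₁).Coprime (r * n₂) := by
    rw [Nat.coprime_comm, Nat.Coprime, hr.gcd_eq, Nat.gcd_one_left]
  exact this.coprime_dvd_right (Nat.mul_dvd_mul_left r (R.dvd_n₂ hv))

theorem orderOf_rootConst (hr : r * n₂ ≡ 1 [MOD orderOf a * D₁]) {v : ℕ} (hv : v ∣ n₂ / D₂)
    (j i m : ℕ) : orderOf (rootConst (Fintype.card F) r ζ₁ ζ₂ b j v i m) =
      orderOf a * D₁ * (D₂ / i.gcd D₂) := by
  have orderOf_left : orderOf (ζ₂ ^ (i * Fintype.card F ^ m)) = D₂ / i.gcd D₂ := by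
    rw [orderOf_primitiveRoot_pow R.D₂_ne_zero R.isPrimitiveRoot₂, Nat.Coprime.gcd_mul_right_cancel]
    exact ((R.coprime_q.coprime_dvd_left (R.D₂_dvd.trans (dvd_mul_left _ _))).pow_right m).symm
  have orderOf_right : orderOf ((ζ₁ ^ j * b) ^ (r * v)) = orderOf a * D₁ := by
    rw [Nat.Coprime.orderOf_pow, R.orderOf_root]
    exact R.orderOf_root j ▸ R.coprime_mul hr hv
  rw [rootConst, mul_comm, (Commute.all _ _).orderOf_mul_eq_mul_orderOf_of_coprime, orderOf_left,
    orderOf_right]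
  rw [orderOf_left, orderOf_right]
  exact R.coprime_mul_div_gcd i

theorem rootConst_ne_zero (j v i m : ℕ) : rootConst (Fintype.card F) r ζ₁ ζ₂ b j v i m ≠ 0 :=
  mul_ne_zero (pow_ne_zero _ (R.isPrimitiveRoot₂.ne_zero R.D₂_ne_zero))
    (pow_ne_zero _ (R.root_ne_zero j))

theorem natDegree_minpoly_rootConst (hr : r * n₂ ≡ 1 [MOD orderOf a * D₁]) {v : ℕ}
    (hv : v ∣ n₂ / D₂) (j i m : ℕ) :
    (minpoly F (rootConst (Fintype.card F) r ζ₁ ζ₂ b j v i m)).natDegree =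
      cDegree (Fintype.card F) (orderOf a) n₁ n₂ s i := by
  have := R.finiteDimensional
  refine Nat.dvd_right_iff_eq.1 fun d ↦ ?_
  rw [← pow_card_pow_eq_self_iff (.of_finite F _), ← R.mul_dvd_pow_sub_one_iff,
    pow_pow_eq_self_iff (R.rootConst_ne_zero j v i m) Fintype.card_pos,
    R.orderOf_rootConst hr hv]

end

variable (R : RootData a n₁ n₂ s D₁ D₂ s₁ b ζ₁ ζ₂) (hr : r * n₂ ≡ 1 [MOD orderOf a * D₁])
  {v : ℕ} (hv : v ∣ n₂ / D₂)

section

include R hv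

theorem map_spinFactor_eq_qSpin (j i m : ℕ) :
    (spinFactor F (n₁ / D₁) r ζ₁ ζ₂ b j v i m).map (algebraMap F L) =
      qSpin F (X ^ (n₁ / D₁ * v) - C (rootConst (Fintype.card F) r ζ₁ ζ₂ b j v i m)) := by
  have := R.finiteDimensional
  rw [spinFactor, map_expand_minpoly_eq_prod _ (.of_finite F _),
    qSpin_X_pow_sub_C (R.exponent_ne_zero hv) (.of_finite F _)]

theorem monic_spinFactor (j i m : ℕ) : (spinFactor F (n₁ / D₁) r ζ₁ ζ₂ b j v i m).Monic :=
  have := R.finiteDimensional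
  (monic_expand_iff (Nat.pos_of_ne_zero (R.exponent_ne_zero hv))).2 (minpoly.monic (.of_finite F _))

include hr

theorem map_spinFactor (j i m : ℕ) :
    (spinFactor F (n₁ / D₁) r ζ₁ ζ₂ b j v i m).map (algebraMap F L) =
      explicitFactor (Fintype.card F) (n₁ / D₁ * v)
        (cDegree (Fintype.card F) (orderOf a) n₁ n₂ s i)
        (rootConst (Fintype.card F) r ζ₁ ζ₂ b j v i m) := by
  have := R.finiteDimensional
  rw [spinFactor, map_expand_minpoly_eq_prod _ (.of_finite F _),
    R.natDegree_minpoly_rootConst hr hv, explicitFactor_eq_prod]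

theorem natDegree_spinFactor (j i m : ℕ) : (spinFactor F (n₁ / D₁) r ζ₁ ζ₂ b j v i m).natDegree =
    n₁ / D₁ * v * cDegree (Fintype.card F) (orderOf a) n₁ n₂ s i := by
  rw [spinFactor, natDegree_expand, R.natDegree_minpoly_rootConst hr hv, mul_comm]

theorem serretCondition_rootConst {i : ℕ} (hiv : i.Coprime v) (j m : ℕ) :
    SerretCondition
      (Fintype.card F ^ (minpoly F (rootConst (Fintype.card F) r ζ₁ ζ₂ b j v i m)).natDegree)
      (orderOf (rootConst (Fintype.card F) r ζ₁ ζ₂ b j v i m)) (n₁ / D₁ * v) := by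
  rw [R.natDegree_minpoly_rootConst hr hv, R.orderOf_rootConst hr hv]
  exact R.serretCondition hv hiv

theorem irreducible_spinFactor {i : ℕ} (hiv : i.Coprime v) (j m : ℕ) :
    Irreducible (spinFactor F (n₁ / D₁) r ζ₁ ζ₂ b j v i m) :=
  (R.serretCondition_rootConst hr hv hiv j m).irreducible_and_hasOrder_expand_minpoly.1

theorem hasOrder_spinFactor {i : ℕ} (hiv : i.Coprime v) (j m : ℕ) :
    HasOrder (spinFactor F (n₁ / D₁) r ζ₁ ζ₂ b j v i m)
      (orderOf a * n₁ * v * (D₂ / i.gcd D₂)) := by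
  have horder : orderOf a * n₁ * v * (D₂ / i.gcd D₂) =
      n₁ / D₁ * v * (orderOf a * D₁ * (D₂ / i.gcd D₂)) := by
    conv_lhs => rw [← Nat.div_mul_cancel R.D₁_dvd]
    ring
  rw [horder, ← R.orderOf_rootConst hr hv j i m]
  exact (R.serretCondition_rootConst hr hv hiv j m).irreducible_and_hasOrder_expand_minpoly.2

theorem spinFactor_dvd (j i m : ℕ) :
    spinFactor F (n₁ / D₁) r ζ₁ ζ₂ b j v i m ∣ X ^ (n₁ * n₂) - C a := by
  obtain ⟨w, hw⟩ := hv
  have hn₂ : n₂ = v * D₂ * w := by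
    rw [← Nat.div_mul_cancel R.D₂_dvd, hw]
    ring
  have hn : n₁ * n₂ = n₁ / D₁ * v * (D₁ * D₂ * w) := by
    conv_lhs => rw [← Nat.div_mul_cancel R.D₁_dvd, hn₂]
    ring
  have rootConst_pow :
      rootConst (Fintype.card F) r ζ₁ ζ₂ b j v i m ^ (D₁ * D₂ * w) = algebraMap F L a := calc
    _ = (ζ₂ ^ D₂) ^ (i * Fintype.card F ^ m * D₁ * w) *
        ((ζ₁ ^ j * b) ^ (r * (v * D₂ * w))) ^ D₁ := by
      simp only [rootConst, mul_pow _ _ (D₁ * D₂ * w), ← pow_mul]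
      ring_nf
    _ = algebraMap F L a := by
      rw [R.isPrimitiveRoot₂.pow_eq_one, one_pow, one_mul, ← hn₂, R.root_pow_mul hr, R.root_pow]
  have minpoly_dvd : minpoly F (rootConst (Fintype.card F) r ζ₁ ζ₂ b j v i m) ∣
      X ^ (D₁ * D₂ * w) - C a :=
    minpoly.dvd F _ (by rw [map_sub, map_pow, aeval_X, aeval_C, rootConst_pow, sub_self])
  simpa only [spinFactor, map_sub, map_pow, expand_X, expand_C, ← pow_mul, ← hn] using
    map_dvd (expand F (n₁ / D₁ * v)) minpoly_dvd

end

section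

include R hr hv

theorem isConjRoot_rootConst_iff (j j' i i' m m' : ℕ) :
    IsConjRoot F (rootConst (Fintype.card F) r ζ₁ ζ₂ b j v i m)
        (rootConst (Fintype.card F) r ζ₁ ζ₂ b j' v i' m') ↔
      ∃ u, (ζ₂ ^ i') ^ Fintype.card F ^ m' = (ζ₂ ^ i) ^ Fintype.card F ^ (m + u) ∧
        ζ₁ ^ j' * b = (ζ₁ ^ j * b) ^ Fintype.card F ^ u := by
  rw [R.isConjRoot_iff]
  refine exists_congr fun u ↦ ?_
  have rootConst_pow : rootConst (Fintype.card F) r ζ₁ ζ₂ b j v i m ^ Fintype.card F ^ u =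
      (ζ₂ ^ i) ^ Fintype.card F ^ (m + u) *
        ((ζ₁ ^ j * b) ^ Fintype.card F ^ u) ^ (r * v) := by
    rw [rootConst, mul_pow, pow_right_comm _ (r * v), pow_add, pow_mul, pow_mul (ζ₂ ^ i)]
  rw [rootConst_pow, rootConst, pow_mul]
  refine ⟨fun h ↦ ?_, fun ⟨h₂, h₁⟩ ↦ by rw [h₂, h₁]⟩
  have primitiveRoot_pow_eq_one (i k : ℕ) : ((ζ₂ ^ i) ^ k) ^ D₂ = 1 := by
    rw [pow_right_comm, pow_right_comm ζ₂, R.isPrimitiveRoot₂.pow_eq_one, one_pow, one_pow]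
  have root_pow_pow_eq_one (j k : ℕ) : ((ζ₁ ^ j * b) ^ k) ^ (orderOf a * D₁) = 1 := by
    rw [pow_right_comm, R.root_pow_eq_one, one_pow]
  obtain ⟨h₂, h₁⟩ := eq_and_eq_of_mul_eq_mul_of_coprime
    (R.coprime_mul_D₁.coprime_dvd_left R.D₂_dvd) (primitiveRoot_pow_eq_one _ _)
    (primitiveRoot_pow_eq_one _ _) (root_pow_pow_eq_one _ _)
    (by rw [pow_right_comm, root_pow_pow_eq_one, one_pow]) h
  exact ⟨h₂, eq_of_pow_eq_pow_of_coprime (R.coprime_mul hr hv) (R.root_pow_eq_one _)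
    (root_pow_pow_eq_one _ _) h₁⟩

variable {J I : Finset ℕ} (hJ : IsRepSystem (FrobRel (Fintype.card F) s₁ ζ₁ b) D₁ J)
  (hI : IsCyclotomicRepSystem (Fintype.card F) D₂ I)
include hJ hI

theorem eq_of_isConjRoot_rootConst {j j' i i' m m' : ℕ} (hj : j ∈ J) (hj' : j' ∈ J) (hi : i ∈ I)
    (hi' : i' ∈ I) (hm : m < (tMin (Fintype.card F) n₂ s i).gcd s₁)
    (hm' : m' < (tMin (Fintype.card F) n₂ s i').gcd s₁)
    (h : IsConjRoot F (rootConst (Fintype.card F) r ζ₁ ζ₂ b j v i m)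
      (rootConst (Fintype.card F) r ζ₁ ζ₂ b j' v i' m')) : j = j' ∧ i = i' ∧ m = m' := by
  obtain ⟨u, h₂, h₁⟩ := (R.isConjRoot_rootConst_iff hr hv j j' i i' m m').1 h
  obtain rfl : j = j' := hJ.eq_of_rel hj hj' ((R.frobRel_iff j j).2 .refl)
    ((R.frobRel_iff j j').2 (R.isConjRoot_iff.2 ⟨u, h₁⟩))
  have mem_coset {k : ℕ} (hk : k ∈ I) :=
    R.mem_cyclotomicCoset_iff i (Finset.mem_range.1 (hI.1 hk))
  have conj : IsConjRoot F (ζ₂ ^ i) (ζ₂ ^ i') :=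
    (R.isConjRoot_iff.2 ⟨_, h₂⟩).trans (R.isConjRoot_iff.2 ⟨m', rfl⟩).symm
  obtain rfl : i = i' := hI.eq_of_rel hi hi' ((mem_coset hi).2 .refl) ((mem_coset hi').2 conj)
  have hu : s₁ ∣ u := (R.root_pow_card_pow_eq_self_iff j u).1 h₁.symm
  have modEq := (pow_card_pow_eq_iff_modEq (R.primitiveRoot_pow_card_pow_eq_self_iff i) _ _).1 h₂
  refine ⟨rfl, rfl, (Nat.ModEq.eq_of_lt_of_lt ?_ hm' hm).symm⟩
  exact (modEq.of_dvd (Nat.gcd_dvd_left _ _)).trans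
    ((Nat.modEq_zero_iff_dvd.2 ((Nat.gcd_dvd_right _ _).trans hu)).add_left m)

theorem exists_isConjRoot_rootConst {k l : ℕ} (hk : k < D₁) (hl : l < D₂) (hlv : l.Coprime v) :
    ∃ j ∈ J, ∃ i ∈ I, i.Coprime v ∧ ∃ m < (tMin (Fintype.card F) n₂ s i).gcd s₁,
      IsConjRoot F (rootConst (Fintype.card F) r ζ₁ ζ₂ b j v i m)
        (rootConst (Fintype.card F) r ζ₁ ζ₂ b k v l 0) := by
  obtain ⟨j, ⟨hj, hkj⟩, -⟩ := hJ.2 k hk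
  obtain ⟨i, ⟨hi, hli⟩, -⟩ := hI.2 l hl
  have conj₁ := ((R.frobRel_iff k j).1 hkj).symm
  have conj₂ := ((R.mem_cyclotomicCoset_iff l (Finset.mem_range.1 (hI.1 hi))).1 hli).symm
  have hiv : i.Coprime v :=
    R.coprime_of_mem_cyclotomicCoset hv ((R.mem_cyclotomicCoset_iff i hl).2 conj₂) hlv
  obtain ⟨κ, hκ⟩ := R.isConjRoot_iff.1 conj₁
  obtain ⟨μ, hμ⟩ := R.isConjRoot_iff.1 conj₂
  have tMin_ne_zero : tMin (Fintype.card F) n₂ s i ≠ 0 :=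
    ne_zero_of_dvd_ne_zero R.s_pos.ne' (R.tMin_dvd_s i)
  obtain ⟨m, hm, u, huμ, huκ⟩ := exists_add_modEq_and_modEq (σ := s₁) tMin_ne_zero μ κ
  refine ⟨j, hj, i, hi, hiv, m, hm, (R.isConjRoot_rootConst_iff hr hv _ _ _ _ _ _).2 ⟨u, ?_, ?_⟩⟩
  · rw [pow_zero, pow_one, hμ]
    exact ((pow_card_pow_eq_iff_modEq (R.primitiveRoot_pow_card_pow_eq_self_iff i) _ _).2 huμ).symm
  · rw [hκ]
    exact ((pow_card_pow_eq_iff_modEq (R.root_pow_card_pow_eq_self_iff j) _ _).2 huκ).symm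

end

section

variable {J I : Finset ℕ}
include R hr

theorem injOn_spinFactor (hJ : IsRepSystem (FrobRel (Fintype.card F) s₁ ζ₁ b) D₁ J)
    (hI : IsCyclotomicRepSystem (Fintype.card F) D₂ I) :
    Set.InjOn (fun k : Σ _ : ℕ, Σ _ : ℕ, Σ _ : ℕ, ℕ ↦
        spinFactor F (n₁ / D₁) r ζ₁ ζ₂ b k.1 k.2.1 k.2.2.1 k.2.2.2)
      (indexSet J I (n₂ / D₂) fun i ↦ (tMin (Fintype.card F) n₂ s i).gcd s₁) := by
  rintro ⟨j, v, i, m⟩ hk ⟨j', v', i', m'⟩ hk' h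
  dsimp only at h
  have hN := R.div_D₂_ne_zero
  obtain ⟨hj, hv, ⟨hi, hiv⟩, hm⟩ := (mem_indexSet hN).1 hk
  obtain ⟨hj', hv', ⟨hi', hiv'⟩, hm'⟩ := (mem_indexSet hN).1 hk'
  have order_eq := (R.hasOrder_spinFactor hr hv hiv j m).unique
    (h ▸ R.hasOrder_spinFactor hr hv' hiv' j' m')
  rw [mul_assoc (_ * _), mul_assoc (_ * _)] at order_eq
  obtain rfl : v = v' := eq_of_mul_div_gcd_eq R.D₂_ne_zero hiv hiv' <|
    Nat.eq_of_mul_eq_mul_left (Nat.pos_of_ne_zero (mul_ne_zero R.e_ne_zero R.n₁_ne_zero)) order_eq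
  have conj : IsConjRoot F (rootConst (Fintype.card F) r ζ₁ ζ₂ b j v i m)
      (rootConst (Fintype.card F) r ζ₁ ζ₂ b j' v i' m') :=
    expand_injective (Nat.pos_of_ne_zero (R.exponent_ne_zero hv)) h
  obtain ⟨rfl, rfl, rfl⟩ := R.eq_of_isConjRoot_rootConst hr hv hJ hI hj hj' hi hi' hm hm' conj
  rfl

theorem exists_pow_eq_algebraMap_rootConst {Ω : Type*} [Field Ω] [Algebra F Ω] [Algebra L Ω]
    [IsScalarTower F L Ω] {x : Ω} (hx : x ^ (n₁ * n₂) = algebraMap F Ω a) :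
    ∃ k < D₁, ∃ v, v ∣ n₂ / D₂ ∧ ∃ l < D₂, l.Coprime v ∧
      x ^ (n₁ / D₁ * v) = algebraMap L Ω (rootConst (Fintype.card F) r ζ₁ ζ₂ b k v l 0) := by
  have inj := (algebraMap L Ω).injective
  have pow_eq : ((x ^ (n₁ / D₁)) ^ n₂) ^ D₁ = algebraMap L Ω b ^ D₁ := by
    rw [← map_pow, R.pow_eq, ← IsScalarTower.algebraMap_apply, ← hx, pow_right_comm, ← pow_mul x,
      Nat.div_mul_cancel R.D₁_dvd, ← pow_mul]
  obtain ⟨k, hk, hy⟩ := exists_eq_primitiveRoot_pow_mul R.D₁_ne_zero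
    (R.isPrimitiveRoot₁.map_of_injective inj) pow_eq
  rw [← map_pow, ← map_mul] at hy
  set g := algebraMap L Ω (ζ₁ ^ k * b) with hg
  have hg0 : g ≠ 0 := (_root_.map_ne_zero _).2 (R.root_ne_zero k)
  have quotient_pow : (x ^ (n₁ / D₁) / g ^ r) ^ n₂ = 1 := by
    rw [div_pow, hy, ← pow_mul, hg, ← map_pow, R.root_pow_mul hr, ← hg, div_self hg0]
  obtain ⟨v, hv, l, hl, hlv, hz⟩ := exists_pow_eq_primitiveRoot_pow R.n₂_ne_zero R.D₂_dvd
    (fun _ ↦ R.prime_dvd_D₂) (R.isPrimitiveRoot₂.map_of_injective inj) quotient_pow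
  refine ⟨k, hk, v, hv, l, hl, hlv, ?_⟩
  rw [div_pow, div_eq_iff (pow_ne_zero _ (pow_ne_zero _ hg0)), ← pow_mul, ← pow_mul] at hz
  rw [hz, rootConst, pow_zero, mul_one, map_mul, map_pow, map_pow]

theorem exists_aeval_spinFactor_eq_zero (hJ : IsRepSystem (FrobRel (Fintype.card F) s₁ ζ₁ b) D₁ J)
    (hI : IsCyclotomicRepSystem (Fintype.card F) D₂ I) {Ω : Type*} [Field Ω] [Algebra F Ω]
    [Algebra L Ω] [IsScalarTower F L Ω] {x : Ω} (hx : x ^ (n₁ * n₂) = algebraMap F Ω a) :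
    ∃ j ∈ J, ∃ v, v ∣ n₂ / D₂ ∧ ∃ i ∈ I, i.Coprime v ∧
      ∃ m < (tMin (Fintype.card F) n₂ s i).gcd s₁,
        aeval x (spinFactor F (n₁ / D₁) r ζ₁ ζ₂ b j v i m) = 0 := by
  obtain ⟨k, hk, v, hv, l, hl, hlv, hxk⟩ := R.exists_pow_eq_algebraMap_rootConst hr hx
  obtain ⟨j, hj, i, hi, hiv, m, hm, conj⟩ := R.exists_isConjRoot_rootConst hr hv hJ hI hk hl hlv
  refine ⟨j, hj, v, hv, i, hi, hiv, m, hm, ?_⟩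
  rw [spinFactor, expand_aeval, hxk, aeval_algebraMap_apply, conj, minpoly.aeval, map_zero]

theorem X_pow_sub_C_eq_prod_spinFactor (ha : a ≠ 0)
    (hJ : IsRepSystem (FrobRel (Fintype.card F) s₁ ζ₁ b) D₁ J)
    (hI : IsCyclotomicRepSystem (Fintype.card F) D₂ I) :
    X ^ (n₁ * n₂) - C a = ∏ j ∈ J, ∏ v ∈ (n₂ / D₂).divisors, ∏ i ∈ I with i.Coprime v,
      ∏ m ∈ Finset.range ((tMin (Fintype.card F) n₂ s i).gcd s₁),
        spinFactor F (n₁ / D₁) r ζ₁ ζ₂ b j v i m := by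
  have hN := R.div_D₂_ne_zero
  have prod_indexSet := eq_prod_of_forall_root (AlgebraicClosure L)
    (monic_X_pow_sub_C a R.ne_zero)
    (separable_X_pow_sub_C a (natCast_ne_zero_of_coprime_card R.coprime_q) ha)
    (K := indexSet J I (n₂ / D₂) fun i ↦ (tMin (Fintype.card F) n₂ s i).gcd s₁)
    (S := fun k ↦ spinFactor F (n₁ / D₁) r ζ₁ ζ₂ b k.1 k.2.1 k.2.2.1 k.2.2.2)
    (fun _ hk ↦ R.monic_spinFactor ((mem_indexSet hN).1 hk).2.1 _ _ _)
    (fun _ hk ↦ R.irreducible_spinFactor hr ((mem_indexSet hN).1 hk).2.1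
      ((mem_indexSet hN).1 hk).2.2.1.2 _ _)
    (fun _ hk ↦ R.spinFactor_dvd hr ((mem_indexSet hN).1 hk).2.1 _ _ _)
    (R.injOn_spinFactor hr hJ hI) fun x hx ↦ by
      rw [map_sub, map_pow, aeval_X, aeval_C, sub_eq_zero] at hx
      obtain ⟨j, hj, v, hv, i, hi, hiv, m, hm, hroot⟩ :=
        R.exists_aeval_spinFactor_eq_zero hr hJ hI hx
      exact ⟨⟨j, v, i, m⟩, (mem_indexSet hN).2 ⟨hj, hv, ⟨hi, hiv⟩, hm⟩, hroot⟩
  simpa only [indexSet, Finset.prod_sigma] using prod_indexSet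

end

end RootData

end BinomialFactorization

theorem theorem18 {F : Type*} [Field F] [Fintype F] (q : ℕ) (hq : Fintype.card F = q)
    (a : F) (ha : a ≠ 0) (n n₁ n₂ : ℕ) (hnq : Nat.Coprime n q) (hn : n = n₁ * n₂)
    (hn₁ : UniqueFactorizationMonoid.radical n₁ ∣ orderOf a)
    (hn₂ : Nat.Coprime n₂ (orderOf a))
    (s : ℕ) (hs : s = extDegree q n)
    (D₁ D₂ : ℕ) (hD₁ : D₁ = dOne q (orderOf a) n₁ s) (hD₂ : D₂ = dTwo q n₂ s)
    (s₁ : ℕ) (hs₁ : s₁ = sOne q (orderOf a) n₁ s)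
    (t c : ℕ → ℕ) (ht : ∀ i, t i = tMin q n₂ s i)
    (hc : ∀ i, c i = cDegree q (orderOf a) n₁ n₂ s i)
    -- `L` is the field with `q ^ s` elements
    {L : Type*} [Field L] [Algebra F L] (hL : Module.finrank F L = s) :
    (∃ b : L, b ^ D₁ = algebraMap F L a) ∧
    (∃ ζ₁ : L, IsPrimitiveRoot ζ₁ D₁) ∧ (∃ ζ₂ : L, IsPrimitiveRoot ζ₂ D₂) ∧
    ∀ (b ζ₁ ζ₂ : L), b ^ D₁ = algebraMap F L a →
      IsPrimitiveRoot ζ₁ D₁ → IsPrimitiveRoot ζ₂ D₂ →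
      Equivalence (fun j k : Fin D₁ => FrobRel q s₁ ζ₁ b j k) ∧
      ∀ r : ℕ, 0 < r → (a = 1 → r = 1) → (a ≠ 1 → r * n₂ ≡ 1 [MOD orderOf a * D₁]) →
      ∀ J I : Finset ℕ, IsRepSystem (FrobRel q s₁ ζ₁ b) D₁ J → IsCyclotomicRepSystem q D₂ I →
      ∃ S : ℕ → ℕ → ℕ → ℕ → F[X],
        (∀ j ∈ J, ∀ v ∈ (n₂ / D₂).divisors, ∀ i ∈ I, Nat.Coprime i v →
          ∀ m < Nat.gcd (t i) s₁,
            (S j v i m).map (algebraMap F L) =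
              explicitFactor q (n₁ / D₁ * v) (c i) (rootConst q r ζ₁ ζ₂ b j v i m) ∧
            (S j v i m).map (algebraMap F L) =
              qSpin F (X ^ (n₁ / D₁ * v) - C (rootConst q r ζ₁ ζ₂ b j v i m)) ∧
            (S j v i m).Monic ∧ Irreducible (S j v i m) ∧
            (S j v i m).natDegree = n₁ / D₁ * v * c i ∧
            HasOrder (S j v i m) (orderOf a * n₁ * v * (D₂ / Nat.gcd i D₂))) ∧
        X ^ n - C a =
          ∏ j ∈ J, ∏ v ∈ (n₂ / D₂).divisors, ∏ i ∈ I with Nat.Coprime i v,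
            ∏ m ∈ Finset.range (Nat.gcd (t i) s₁), S j v i m := by
  subst hq hn
  obtain rfl : t = tMin (Fintype.card F) n₂ s := _root_.funext ht
  obtain rfl : c = cDegree (Fintype.card F) (orderOf a) n₁ n₂ s := _root_.funext hc
  have card_sub_one : orderOf a ∣ Fintype.card F - 1 :=
    orderOf_dvd_of_pow_eq_one (FiniteField.pow_card_sub_one_eq_one a ha)
  have P : Parameters (Fintype.card F) (orderOf a) n₁ n₂ s D₁ D₂ s₁ :=
    ⟨Fintype.one_lt_card, card_sub_one, hnq, hn₁, hn₂, hs, hD₁, hD₂, hs₁⟩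
  have : FiniteDimensional F L := .of_finrank_pos (hL ▸ P.s_pos)
  have : Finite L := Module.finite_of_finite F
  have card_eq : Nat.card L = Fintype.card F ^ s := by
    rw [Module.natCard_eq_pow_finrank (K := F), hL, Nat.card_eq_fintype_card]
  have dvd₁ : orderOf a * D₁ ∣ Nat.card L - 1 := card_eq ▸ P.mul_D₁_dvd_pow_sub_one
  have dvd₂ : D₂ ∣ Nat.card L - 1 := card_eq ▸ P.D₂_dvd_pow_sub_one
  refine ⟨exists_pow_eq_of_orderOf_mul_dvd (by rwa [orderOf_algebraMap]),
    exists_isPrimitiveRoot_of_dvd_card_sub_one ((dvd_mul_left _ _).trans dvd₁),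
    exists_isPrimitiveRoot_of_dvd_card_sub_one dvd₂, fun b ζ₁ ζ₂ hb hζ₁ hζ₂ ↦ ?_⟩
  have R : RootData a n₁ n₂ s D₁ D₂ s₁ b ζ₁ ζ₂ := ⟨P, hL, hb, hζ₁, hζ₂⟩
  refine ⟨R.equivalence_frobRel, fun r _ _ hr J I hJ hI ↦ ?_⟩
  have hr : r * n₂ ≡ 1 [MOD orderOf a * D₁] := (eq_or_ne a 1).elim
    (fun h ↦ by simp [P.D₁_eq_one (orderOf_eq_one_iff.2 h), h, Nat.modEq_one]) hr
  refine ⟨spinFactor F (n₁ / D₁) r ζ₁ ζ₂ b, fun j _ v hv i _ hiv m _ ↦ ?_,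
    R.X_pow_sub_C_eq_prod_spinFactor hr ha hJ hI⟩
  have hv := Nat.dvd_of_mem_divisors hv
  exact ⟨R.map_spinFactor hr hv j i m, R.map_spinFactor_eq_qSpin hv j i m,
    R.monic_spinFactor hv j i m, R.irreducible_spinFactor hr hv hiv j m,
    R.natDegree_spinFactor hr hv j i m, R.hasOrder_spinFactor hr hv hiv j m⟩
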